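/- Let $k$ be a field of characteristic $0$. Let $\Lambda$ be Connes' cyclic category, with objects $[n]$, $n\ge 0$, containing the simplex category $\Delta$ with its cofaces $\partial_j\colon[n]\to[n+1]$ ($0\le j\le n+1$) and the cyclic operators $\tau_n\colon[n]\to[n]$, $\tau_n^{n+1}=\mathrm{id}$, and let ${\bf T}\subset\Lambda$ be the subcategory generated by the $\tau_n$ for all $n$. A left (resp. right) $\Lambda$-module is a covariant (resp. contravariant) functor from $\Lambda$ to $k$-modules; right $\Lambda$-modules are called cyclic modules, left $\Lambda$-modules cocyclic modules. Let $k_\bullet$ be the constant left $\Lambda$-module with value $k$. A morphism of $\Lambda$-modules is a $(\Lambda,{\bf T})$-epimorphism if it is an epimorphism and is split as a morphism of ${\bf T}$-modules; a $\Lambda$-module is $(\Lambda,{\bf T})$-projective if it has the lifting property with respect to all $(\Lambda,{\bf T})$-epimorphisms. A $(\Lambda,{\bf T})$-projective resolution of $k_\bullet$ is a complex $\cdots\to P_1\to P_0\to k_\bullet\to 0$ with every $P_n$ $(\Lambda,{\bf T})$-projective, such that $P_0\to k_\bullet$, $P_1\to\ker(P_0\to k_\bullet)$ and $P_{n+2}\to\ker(P_{n+1}\to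 P_n)$ for $n\ge 0$ are $(\Lambda,{\bf T})$-epimorphisms. For a right module $X_\bullet$ and a left module $Y_\bullet$ put $$\mathrm{Tor}^{(\Lambda,{\bf T})}_n(X_\bullet,k_\bullet)=H_n(X_\bullet\otimes_\Lambda P_*),\qquad \mathrm{Ext}_{(\Lambda,{\bf T})}^n(k_\bullet,Y_\bullet)=H^n(\mathrm{Hom}_\Lambda(P_*,Y_\bullet)).$$ For a cyclic module $X_\bullet$ let ${\rm CH}^\lambda_*(X_\bullet)$ be the quotient of its Hochschild complex $(X_n,\ \sum_j(-1)^j\partial_j)$ by the image of $1-(-1)^n\tau_n$ in each degree $n$ (the cyclic coinvariants), and for a cocyclic module $Y_\bullet$ let ${\rm CH}_\lambda^*(Y_\bullet)$ be the subcomplex of its Hochschild complex $(Y_n,\ \sum_j(-1)^j\partial_j)$ consisting in degree $n$ of the elements $y$ with $(-1)^n\tau_n y=y$ (the cyclic invariants). Let $HC^\lambda_*(X_\bullet)$ and $HC_\lambda^*(Y_\bullet)$ be their (co)homologies. **Theorem.** There exists a $(\Lambda,{\bf T})$-projective resolution of $k_\bullet$, and for every such resolution $P_*$ and every $n\ge 0$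 there are isomorphisms of $k$-modules $$\mathrm{Tor}^{(\Lambda,{\bf T})}_n(X_\bullet,k_\bullet)\cong HC^\lambda_n(X_\bullet),\qquad \mathrm{Ext}_{(\Lambda,{\bf T})}^n(k_\bullet,Y_\bullet)\cong HC_\lambda^n(Y_\bullet),$$ natural in the cyclic module $X_\bullet$ and in the cocyclic module $Y_\bullet$, respectively. -/

import Mathlib

open CategoryTheory Opposite
open scoped TensorProduct

universe u

noncomputable section

/-! ### Connes' cyclic category -/

namespace ConnesCyclic

/-- A nondecreasing map `f : ℤ → ℤ` with `f (x + (m + 1)) = f x + (n + 1)`. -/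
@[ext]
structure PeriodicMap (m n : ℕ) where
  toFun : ℤ → ℤ
  monotone : Monotone toFun
  map_add_period : ∀ x, toFun (x + (m + 1)) = toFun x + (n + 1)

namespace PeriodicMap

/-- Two periodic maps are identified when they differ by a multiple of the period of the target. -/
instance setoid (m n : ℕ) : Setoid (PeriodicMap m n) where
  r f g := ∃ i : ℤ, ∀ x, g.toFun x = f.toFun x + i * (n + 1)
  iseqv :=
    { refl := fun f => ⟨0, fun x => by simp⟩
      symm := by
        rintro f g ⟨i, h⟩
        exact ⟨-i, fun x => by rw [h]; ring⟩
      trans := by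
        rintro f g h ⟨i, hi⟩ ⟨j, hj⟩
        exact ⟨i + j, fun x => by rw [hj, hi]; ring⟩ }

/-- The identity map. -/
def id (n : ℕ) : PeriodicMap n n := ⟨fun x => x, monotone_id, fun _ => rfl⟩

/-- Composition, `g` after `f`. -/
def comp {l m n : ℕ} (f : PeriodicMap l m) (g : PeriodicMap m n) : PeriodicMap l n :=
  ⟨fun x => g.toFun (f.toFun x), g.monotone.comp f.monotone, fun x => by
    rw [f.map_add_period, g.map_add_period]⟩

theorem map_add_mul_period {m n : ℕ} (f : PeriodicMap m n) (x i : ℤ) :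
    f.toFun (x + i * (m + 1)) = f.toFun x + i * (n + 1) := by
  induction i using Int.induction_on with
  | zero => simp
  | succ j ih =>
    have h := f.map_add_period (x + j * (m + 1))
    rw [ih] at h
    rw [show x + ((j : ℤ) + 1) * (m + 1) = x + j * (m + 1) + (m + 1) by ring, h]
    ring
  | pred j ih =>
    have h := f.map_add_period (x + (-(j : ℤ) - 1) * (m + 1))
    rw [show x + (-(j : ℤ) - 1) * (m + 1) + (m + 1) = x + -(j : ℤ) * (m + 1) by ring, ih] at h
    linarith

theorem comp_congr {l m n : ℕ} (f f' : PeriodicMap l m) (hf : f ≈ f')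
    (g g' : PeriodicMap m n) (hg : g ≈ g') : f.comp g ≈ f'.comp g' := by
  obtain ⟨i, hi⟩ := hf
  obtain ⟨j, hj⟩ := hg
  refine ⟨i + j, fun x => ?_⟩
  simp only [comp]
  rw [hj, hi, map_add_mul_period]
  ring

end PeriodicMap

/-- Connes' cyclic category `Λ`: its objects are `[n]` for `n : ℕ`. -/
@[ext]
structure Lam : Type where
  len : ℕ

/-- Morphisms `[m] ⟶ [n]` are the nondecreasing maps `f : ℤ → ℤ` with
`f (x + (m + 1)) = f x + (n + 1)`, modulo adding multiples of `n + 1` to `f`. -/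
instance : Category.{0} Lam where
  Hom a b := Quotient (PeriodicMap.setoid a.len b.len)
  id a := ⟦PeriodicMap.id a.len⟧
  comp f g := Quotient.map₂ PeriodicMap.comp PeriodicMap.comp_congr f g
  id_comp f := by
    induction f using Quotient.inductionOn
    rfl
  comp_id f := by
    induction f using Quotient.inductionOn
    rfl
  assoc f g h := by
    induction f using Quotient.inductionOn
    induction g using Quotient.inductionOn
    induction h using Quotient.inductionOn
    rfl

/-- The class in `Λ` of a periodic map. -/
def Lam.mkHom {a b : Lam} (f : PeriodicMap a.len b.len) : a ⟶ b := Quotient.mk _ f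

theorem Lam.mkHom_eq {a b : Lam} {f g : PeriodicMap a.len b.len}
    (h : ∀ x, g.toFun x = f.toFun x) : Lam.mkHom f = Lam.mkHom g :=
  Quotient.sound ⟨0, fun x => by simp [h]⟩

theorem Lam.mkHom_comp {a b c : Lam} (f : PeriodicMap a.len b.len) (g : PeriodicMap b.len c.len) :
    Lam.mkHom f ≫ Lam.mkHom g = Lam.mkHom (a := a) (b := c) (f.comp g) := rfl

/-- The cyclic operator `τ_n : [n] ⟶ [n]`, the class of `x ↦ x - 1`. -/
def tau (a : Lam) : a ⟶ a :=
  Lam.mkHom ⟨fun x => x - 1, fun _ _ h => by simpa using h, fun _ => by ring⟩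

/-- The extension of an order-preserving map `{0,…,m} → {0,…,n}` to a periodic map. -/
def extend {m n : ℕ} (f : Fin (m + 1) →o Fin (n + 1)) : PeriodicMap m n where
  toFun x := (f (Fin.ofNat (m + 1) (x % (m + 1)).toNat) : ℕ) + (x / (m + 1)) * (n + 1)
  monotone := by
    intro x y hxy
    have hm : (0 : ℤ) < m + 1 := by positivity
    have hx0 := Int.emod_nonneg x hm.ne'
    have hy0 := Int.emod_nonneg y hm.ne'
    have hx1 := Int.emod_lt_of_pos x hm
    have hy1 := Int.emod_lt_of_pos y hm
    have hq : x / (m + 1) ≤ y / (m + 1) := Int.ediv_le_ediv hm hxy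
    have fx := (f (Fin.ofNat (m + 1) (x % (m + 1)).toNat)).isLt
    dsimp only
    rcases hq.eq_or_lt with hq | hq
    · have hr : x % (m + 1) ≤ y % (m + 1) := by
        rw [Int.emod_def, Int.emod_def, hq]; linarith
      have hle : Fin.ofNat (m + 1) (x % (m + 1)).toNat ≤ Fin.ofNat (m + 1) (y % (m + 1)).toNat := by
        rw [Fin.le_def]
        simp only [Fin.val_ofNat]
        rw [Nat.mod_eq_of_lt (by omega), Nat.mod_eq_of_lt (by omega)]
        omega
      have := f.monotone hle
      rw [Fin.le_def] at this
      rw [hq]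
      have h' : ((f (Fin.ofNat (m + 1) (x % (m + 1)).toNat) : ℕ) : ℤ) ≤
        ((f (Fin.ofNat (m + 1) (y % (m + 1)).toNat) : ℕ) : ℤ) := by exact_mod_cast this
      linarith
    · have h1 : (x / (m + 1) + 1) * ((n : ℤ) + 1) ≤ (y / (m + 1)) * (n + 1) :=
        mul_le_mul_of_nonneg_right hq (by positivity)
      have h2 : ((f (Fin.ofNat (m + 1) (x % (m + 1)).toNat) : ℕ) : ℤ) < n + 1 := by
        exact_mod_cast fx
      have h3 : (0 : ℤ) ≤ ((f (Fin.ofNat (m + 1) (y % (m + 1)).toNat) : ℕ) : ℤ) := by positivity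
      nlinarith
  map_add_period x := by
    have hm : (0 : ℤ) < m + 1 := by positivity
    rw [Int.add_emod_right, Int.add_ediv_of_dvd_right (dvd_refl _), Int.ediv_self hm.ne']
    ring

theorem extend_apply {m n : ℕ} (f : Fin (m + 1) →o Fin (n + 1)) (i : Fin (m + 1)) (q : ℤ) :
    (extend f).toFun ((i : ℕ) + q * (m + 1)) = (f i : ℕ) + q * (n + 1) := by
  have hm : (0 : ℤ) < m + 1 := by positivity
  have hi : ((i : ℕ) : ℤ) < m + 1 := by exact_mod_cast i.isLt
  have h1 : (((i : ℕ) : ℤ) + q * (m + 1)) % (m + 1) = (i : ℕ) := by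
    rw [Int.add_mul_emod_self_right, Int.emod_eq_of_lt (by positivity) hi]
  have h2 : (((i : ℕ) : ℤ) + q * (m + 1)) / (m + 1) = q := by
    rw [Int.add_mul_ediv_right _ _ hm.ne', Int.ediv_eq_zero_of_lt (by positivity) hi, zero_add]
  have h3 : Fin.ofNat (m + 1) (((i : ℕ) : ℤ).toNat) = i := by
    ext
    simp
  simp only [extend]
  rw [h1, h2, h3]

theorem exists_fin_add (m : ℕ) (x : ℤ) :
    ∃ (i : Fin (m + 1)) (q : ℤ), x = (i : ℕ) + q * (m + 1) := by
  have hm : (0 : ℤ) < m + 1 := by positivity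
  have h0 := Int.emod_nonneg x hm.ne'
  have h1 := Int.emod_lt_of_pos x hm
  refine ⟨⟨(x % (m + 1)).toNat, by omega⟩, x / (m + 1), ?_⟩
  have := Int.emod_add_mul_ediv x (m + 1)
  simp only [Int.toNat_of_nonneg h0]
  linarith

/-- The inclusion `Δ ⥤ Λ` of the simplex category. -/
def ofSimplex : SimplexCategory ⥤ Lam where
  obj a := ⟨a.len⟩
  map f := Lam.mkHom (a := ⟨_⟩) (b := ⟨_⟩) (extend f.toOrderHom)
  map_id a := by
    refine Lam.mkHom_eq (a := ⟨_⟩) (b := ⟨_⟩) fun x => ?_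
    obtain ⟨i, q, rfl⟩ := exists_fin_add a.len x
    rw [extend_apply]
    rfl
  map_comp {a b c} f g := by
    rw [Lam.mkHom_comp]
    refine Lam.mkHom_eq (a := ⟨_⟩) (b := ⟨_⟩) fun x => ?_
    obtain ⟨i, q, rfl⟩ := exists_fin_add a.len x
    simp only [PeriodicMap.comp]
    rw [extend_apply, extend_apply, extend_apply]
    rfl

/-- The coface `∂_j : [n] ⟶ [n+1]` of `Λ`. -/
abbrev coface {n : ℕ} (j : Fin (n + 2)) : Lam.mk n ⟶ Lam.mk (n + 1) :=
  ofSimplex.map (SimplexCategory.δ j)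

theorem extend_delta {n : ℕ} (j : Fin (n + 2)) (i : ℕ) (hi : i < n + 1) (q : ℤ) :
    (extend (SimplexCategory.δ j).toOrderHom).toFun (i + q * (n + 1)) =
      (if i < (j : ℕ) then (i : ℤ) else i + 1) + q * (n + 2) := by
  have h := extend_apply (SimplexCategory.δ j).toOrderHom ⟨i, hi⟩ q
  have e : (((SimplexCategory.δ j).toOrderHom ⟨i, hi⟩ : Fin (n + 2)) : ℕ) =
      if i < (j : ℕ) then i else i + 1 := by
    change ((Fin.succAbove j ⟨i, hi⟩ : Fin (n + 2)) : ℕ) = _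
    simp only [Fin.succAbove, Fin.lt_def, Fin.val_castSucc]
    split_ifs <;> rfl
  refine h.trans ?_
  erw [e]
  split_ifs <;> push_cast <;> ring

theorem coface_succ_tau {n : ℕ} (j : Fin (n + 1)) :
    coface j.succ ≫ tau ⟨n + 1⟩ = tau ⟨n⟩ ≫ coface j.castSucc := by
  refine Lam.mkHom_eq (a := ⟨n⟩) (b := ⟨n + 1⟩) fun x => ?_
  obtain ⟨⟨i, hi⟩, q, rfl⟩ := exists_fin_add n x
  change (extend (SimplexCategory.δ j.castSucc).toOrderHom).toFun ((i : ℤ) + q * (n + 1) - 1) =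
    (extend (SimplexCategory.δ j.succ).toOrderHom).toFun ((i : ℤ) + q * (n + 1)) - 1
  rw [extend_delta _ i hi]
  have hj := j.isLt
  rcases i with _ | i
  · have e : ((0 : ℕ) : ℤ) + q * (n + 1) - 1 = (n : ℕ) + (q - 1) * (n + 1) := by
      push_cast; ring
    rw [e, extend_delta _ n (by omega), if_neg (by simp; omega), if_pos (by simp)]
    push_cast; ring
  · have e : ((i + 1 : ℕ) : ℤ) + q * (n + 1) - 1 = (i : ℕ) + q * (n + 1) := by
      push_cast; ring
    rw [e, extend_delta _ i (by omega)]
    simp only [Fin.val_castSucc, Fin.val_succ, add_lt_add_iff_right]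
    split_ifs <;> push_cast <;> ring

theorem coface_zero_tau (n : ℕ) :
    coface (0 : Fin (n + 2)) ≫ tau ⟨n + 1⟩ = coface (Fin.last (n + 1)) := by
  refine Lam.mkHom_eq (a := ⟨n⟩) (b := ⟨n + 1⟩) fun x => ?_
  obtain ⟨⟨i, hi⟩, q, rfl⟩ := exists_fin_add n x
  change (extend (SimplexCategory.δ (Fin.last (n + 1))).toOrderHom).toFun
      ((i : ℤ) + q * (n + 1)) =
    (extend (SimplexCategory.δ (0 : Fin (n + 2))).toOrderHom).toFun ((i : ℤ) + q * (n + 1)) - 1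
  rw [extend_delta _ i hi, extend_delta _ i hi, if_pos (by simpa using hi), if_neg (by simp)]
  ring

/-- The subcategory `T` of `Λ` generated by the cyclic operators `τ_n`. -/
abbrev Rot : Type := WideSubcategory (MorphismProperty.ofHoms tau).multiplicativeClosure

/-- The inclusion of `T` in `Λ`. -/
abbrev rotInclusion : Rot ⥤ Lam :=
  wideSubcategoryInclusion (MorphismProperty.ofHoms tau).multiplicativeClosure

end ConnesCyclic

/-! ### Relative homological algebra of modules over a category

For a small category `C`, left `C`-modules are functors `C ⥤ ModuleCat k` and right `C`-modules
are functors `Cᵒᵖ ⥤ ModuleCat k`.  A functor `ι : S ⥤ C` plays the role of the inclusion of a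
subalgebra. -/

namespace RelativeHomology

variable {k : Type u} [Field k] {C S : Type} [Category.{0} C] [Category.{0} S]

/-- A `(C, S)`-epimorphism: an epimorphism of left `C`-modules which is a split epimorphism of
`S`-modules. -/
def IsRelEpi (ι : S ⥤ C) {X Y : C ⥤ ModuleCat.{u} k} (f : X ⟶ Y) : Prop :=
  Epi f ∧ IsSplitEpi (Functor.whiskerLeft ι f)

/-- A `(C, S)`-projective left `C`-module. -/
def IsRelProjective (ι : S ⥤ C) (P : C ⥤ ModuleCat.{u} k) : Prop :=
  ∀ ⦃X Y : C ⥤ ModuleCat.{u} k⦄ (f : X ⟶ Y), IsRelEpi ι f →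
    ∀ p : P ⟶ Y, ∃ q : P ⟶ X, q ≫ f = p

/-- A resolution `⋯ → P₂ → P₁ → P₀ → M → 0` of a left `C`-module `M` by `(C, S)`-projective
modules which is `(C, S)`-exact: `P₀` surjects onto `M`, and each later term onto the kernel of
the next map, by a `(C, S)`-epimorphism. -/
structure RelProjectiveResolution (ι : S ⥤ C) (M : C ⥤ ModuleCat.{u} k) where
  complex : ChainComplex (C ⥤ ModuleCat.{u} k) ℕ
  aug : complex.X 0 ⟶ M
  d_comp_aug : complex.d 1 0 ≫ aug = 0
  projective : ∀ n, IsRelProjective ι (complex.X n)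
  relEpi_aug : IsRelEpi ι aug
  relEpi_zero : IsRelEpi ι (Limits.kernel.lift aug (complex.d 1 0) d_comp_aug)
  relEpi_succ : ∀ n, IsRelEpi ι (Limits.kernel.lift (complex.d (n + 1) n)
    (complex.d (n + 2) (n + 1)) (complex.d_comp_d _ _ _))

/-! #### The tensor product `X ⊗_C P` -/

open scoped Classical in
/-- The submodule of `⨁ c, X c ⊗ P c` spanned by the elements `x f ⊗ p - x ⊗ f p`, for
`f : a ⟶ b` in `C`, `x ∈ X b` and `p ∈ P a`. -/
def balancing (X : Cᵒᵖ ⥤ ModuleCat.{u} k) (P : C ⥤ ModuleCat.{u} k) :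
    Submodule k (DirectSum C fun c => X.obj (op c) ⊗[k] P.obj c) :=
  Submodule.span k {z | ∃ (a b : C) (f : a ⟶ b) (x : X.obj (op b)) (p : P.obj a),
    z = DirectSum.lof k C (fun c => X.obj (op c) ⊗[k] P.obj c) a ((X.map f.op).hom x ⊗ₜ[k] p) -
      DirectSum.lof k C (fun c => X.obj (op c) ⊗[k] P.obj c) b (x ⊗ₜ[k] (P.map f).hom p)}

/-- The tensor product over `C` of a right module and a left module. -/
abbrev Tensor (X : Cᵒᵖ ⥤ ModuleCat.{u} k) (P : C ⥤ ModuleCat.{u} k) : Type u :=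
  (DirectSum C fun c => X.obj (op c) ⊗[k] P.obj c) ⧸ balancing X P

theorem balancing_le_comap {X X' : Cᵒᵖ ⥤ ModuleCat.{u} k} {P P' : C ⥤ ModuleCat.{u} k}
    (φ : X ⟶ X') (ψ : P ⟶ P') :
    balancing X P ≤ (balancing X' P').comap (DirectSum.lmap fun c =>
      TensorProduct.map (φ.app (op c)).hom (ψ.app c).hom) := by
  classical
  rw [balancing, Submodule.span_le]
  rintro _ ⟨a, b, f, x, p, rfl⟩
  refine Submodule.subset_span ⟨a, b, f, (φ.app (op b)).hom x, (ψ.app a).hom p, ?_⟩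
  have h1 := ConcreteCategory.congr_hom (φ.naturality f.op) x
  have h2 := ConcreteCategory.congr_hom (ψ.naturality f) p
  simp only [ModuleCat.comp_apply] at h1 h2
  rw [map_sub, DirectSum.lmap_lof, DirectSum.lmap_lof, TensorProduct.map_tmul,
    TensorProduct.map_tmul]
  erw [h1, h2]

/-- The tensor product over `C` on morphisms: `x ⊗ p ↦ φ x ⊗ ψ p`. -/
def tensorMap {X X' : Cᵒᵖ ⥤ ModuleCat.{u} k} {P P' : C ⥤ ModuleCat.{u} k}
    (φ : X ⟶ X') (ψ : P ⟶ P') : Tensor X P →ₗ[k] Tensor X' P' :=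
  Submodule.mapQ _ _ (DirectSum.lmap fun c =>
    TensorProduct.map (φ.app (op c)).hom (ψ.app c).hom) (balancing_le_comap φ ψ)

open scoped Classical in
theorem tensor_hom_ext {X : Cᵒᵖ ⥤ ModuleCat.{u} k} {P : C ⥤ ModuleCat.{u} k} {M : Type u}
    [AddCommGroup M] [Module k M] {f g : Tensor X P →ₗ[k] M}
    (h : ∀ (c : C) (x : X.obj (op c)) (p : P.obj c),
      f (Submodule.Quotient.mk (DirectSum.lof k C (fun c => X.obj (op c) ⊗[k] P.obj c) c
        (x ⊗ₜ[k] p))) =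
      g (Submodule.Quotient.mk (DirectSum.lof k C (fun c => X.obj (op c) ⊗[k] P.obj c) c
        (x ⊗ₜ[k] p)))) : f = g := by
  refine Submodule.linearMap_qext _ (DirectSum.linearMap_ext _ fun c => ?_)
  exact TensorProduct.ext' fun x p => h c x p

open scoped Classical in
theorem tensorMap_mk {X X' : Cᵒᵖ ⥤ ModuleCat.{u} k} {P P' : C ⥤ ModuleCat.{u} k}
    (φ : X ⟶ X') (ψ : P ⟶ P') (c : C) (x : X.obj (op c)) (p : P.obj c) :
    tensorMap φ ψ (Submodule.Quotient.mk
      (DirectSum.lof k C (fun c => X.obj (op c) ⊗[k] P.obj c) c (x ⊗ₜ[k] p))) =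
    Submodule.Quotient.mk (DirectSum.lof k C (fun c => X'.obj (op c) ⊗[k] P'.obj c) c
      ((φ.app (op c)).hom x ⊗ₜ[k] (ψ.app c).hom p)) := by
  simp only [tensorMap]
  erw [Submodule.mapQ_apply]
  rw [DirectSum.lmap_lof, TensorProduct.map_tmul]

theorem tensorMap_id (X : Cᵒᵖ ⥤ ModuleCat.{u} k) (P : C ⥤ ModuleCat.{u} k) :
    tensorMap (𝟙 X) (𝟙 P) = LinearMap.id :=
  tensor_hom_ext fun c x p => by rw [tensorMap_mk]; rfl

theorem tensorMap_comp {X X' X'' : Cᵒᵖ ⥤ ModuleCat.{u} k} {P P' P'' : C ⥤ ModuleCat.{u} k}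
    (φ : X ⟶ X') (φ' : X' ⟶ X'') (ψ : P ⟶ P') (ψ' : P' ⟶ P'') :
    tensorMap (φ ≫ φ') (ψ ≫ ψ') = tensorMap φ' ψ' ∘ₗ tensorMap φ ψ :=
  tensor_hom_ext fun c x p => by
    rw [LinearMap.comp_apply, tensorMap_mk, tensorMap_mk, tensorMap_mk]; rfl

theorem tensorMap_zero {X X' : Cᵒᵖ ⥤ ModuleCat.{u} k} {P P' : C ⥤ ModuleCat.{u} k}
    (φ : X ⟶ X') : tensorMap φ (0 : P ⟶ P') = 0 :=
  tensor_hom_ext fun c x p => by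
    classical
    rw [tensorMap_mk]
    change Submodule.Quotient.mk (DirectSum.lof k C (fun c => X'.obj (op c) ⊗[k] P'.obj c) c
      (_ ⊗ₜ[k] (0 : P'.obj c))) = 0
    rw [TensorProduct.tmul_zero, map_zero]
    rfl

/-- The functor `X ↦ X ⊗_C P_*` from right `C`-modules to chain complexes, for a complex `P_*` of
left `C`-modules. -/
def tensorComplex (P : ChainComplex (C ⥤ ModuleCat.{u} k) ℕ) :
    (Cᵒᵖ ⥤ ModuleCat.{u} k) ⥤ ChainComplex (ModuleCat.{u} k) ℕ where
  obj X :=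
    { X := fun n => ModuleCat.of k (Tensor X (P.X n))
      d := fun i j => ModuleCat.ofHom (tensorMap (𝟙 X) (P.d i j))
      shape := fun i j h => by rw [P.shape i j h, tensorMap_zero]; rfl
      d_comp_d' := fun i j l _ _ => by
        rw [← ModuleCat.ofHom_comp, ← tensorMap_comp, P.d_comp_d, tensorMap_zero]; rfl }
  map φ :=
    { f := fun n => ModuleCat.ofHom (tensorMap φ (𝟙 (P.X n)))
      comm' := fun i j _ => by
        dsimp only
        rw [← ModuleCat.ofHom_comp, ← ModuleCat.ofHom_comp, ← tensorMap_comp, ← tensorMap_comp]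
        simp only [Category.comp_id, Category.id_comp] }
  map_id X := by
    ext n : 1
    exact congrArg ModuleCat.ofHom (tensorMap_id X (P.X n))
  map_comp φ φ' := by
    ext n : 1
    refine (congrArg ModuleCat.ofHom ?_).trans (ModuleCat.ofHom_comp _ _)
    rw [← tensorMap_comp, Category.comp_id]

/-- The functor `Y ↦ Hom_C(P_*, Y)` from left `C`-modules to cochain complexes, for a complex
`P_*` of left `C`-modules. -/
def homComplex (P : ChainComplex (C ⥤ ModuleCat.{u} k) ℕ) :
    (C ⥤ ModuleCat.{u} k) ⥤ CochainComplex (ModuleCat.{u} k) ℕ where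
  obj Y :=
    { X := fun n => ModuleCat.of k (P.X n ⟶ Y)
      d := fun i j => ModuleCat.ofHom (Linear.leftComp k Y (P.d j i))
      shape := fun i j h => by
        ext f : 2
        change P.d j i ≫ f = 0
        rw [P.shape j i h, Limits.zero_comp]
      d_comp_d' := fun i j l _ _ => by
        ext f : 2
        change P.d l j ≫ P.d j i ≫ f = 0
        rw [← Category.assoc, P.d_comp_d, Limits.zero_comp] }
  map ψ :=
    { f := fun n => ModuleCat.ofHom (Linear.rightComp k (P.X n) ψ)
      comm' := fun i j _ => by
        ext f : 2
        change P.d j i ≫ f ≫ ψ = (P.d j i ≫ f) ≫ ψ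
        rw [Category.assoc] }
  map_id Y := by
    ext n f : 3
    exact Category.comp_id (X := P.X n) f
  map_comp ψ ψ' := by
    ext n f : 3
    exact (Category.assoc (W := P.X n) f ψ ψ').symm

/-- The relative Tor functor `X ↦ Tor_n^{(C,S)}(X, M) = H_n(X ⊗_C P_*)` computed by a resolution
`P_*` of `M`. -/
def relTor {ι : S ⥤ C} {M : C ⥤ ModuleCat.{u} k} (P : RelProjectiveResolution ι M) (n : ℕ) :
    (Cᵒᵖ ⥤ ModuleCat.{u} k) ⥤ ModuleCat.{u} k :=
  tensorComplex P.complex ⋙ HomologicalComplex.homologyFunctor _ _ n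

/-- The relative Ext functor `Y ↦ Ext^n_{(C,S)}(M, Y) = H^n(Hom_C(P_*, Y))` computed by a
resolution `P_*` of `M`. -/
def relExt {ι : S ⥤ C} {M : C ⥤ ModuleCat.{u} k} (P : RelProjectiveResolution ι M) (n : ℕ) :
    (C ⥤ ModuleCat.{u} k) ⥤ ModuleCat.{u} k :=
  homComplex P.complex ⋙ HomologicalComplex.homologyFunctor _ _ n

end RelativeHomology

/-! ### Cyclic modules, cocyclic modules and Connes' complexes -/

namespace ConnesCyclic

open AlgebraicTopology

variable (k : Type u) [Field k]

/-- Cyclic modules: right `Λ`-modules. -/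
abbrev CyclicModule := Lamᵒᵖ ⥤ ModuleCat.{u} k

/-- Cocyclic modules: left `Λ`-modules. -/
abbrev CocyclicModule := Lam ⥤ ModuleCat.{u} k

/-- The trivial left `Λ`-module: `k` in every degree, with every morphism acting as identity. -/
abbrev trivialModule : CocyclicModule k := (Functor.const Lam).obj (ModuleCat.of k k)

variable {k}

/-- The Hochschild differential `X_{n+1} → X_n` of a cyclic module: the alternating sum of the
actions of the `∂_j`. -/
def chainD (X : CyclicModule k) (n : ℕ) : X.obj (op ⟨n + 1⟩) ⟶ X.obj (op ⟨n⟩) :=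
  ∑ j : Fin (n + 2), (-1 : ℤ) ^ (j : ℕ) • X.map (coface j).op

/-- The Hochschild differential `Y_n → Y_{n+1}` of a cocyclic module: the alternating sum of the
actions of the `∂_j`. -/
def cochainD (Y : CocyclicModule k) (n : ℕ) : Y.obj ⟨n⟩ ⟶ Y.obj ⟨n + 1⟩ :=
  ∑ j : Fin (n + 2), (-1 : ℤ) ^ (j : ℕ) • Y.map (coface j)

theorem chainD_comp (X : CyclicModule k) (n : ℕ) : chainD X (n + 1) ≫ chainD X n = 0 :=
  AlternatingFaceMapComplex.d_squared (ofSimplex.op ⋙ X) n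

theorem cochainD_comp (Y : CocyclicModule k) (n : ℕ) : cochainD Y n ≫ cochainD Y (n + 1) = 0 :=
  AlternatingCofaceMapComplex.d_squared (ofSimplex ⋙ Y) n

theorem chainD_apply (X : CyclicModule k) (n : ℕ) (x : X.obj (op ⟨n + 1⟩)) :
    (chainD X n).hom x = ∑ j : Fin (n + 2), (-1 : ℤ) ^ (j : ℕ) • (X.map (coface j).op).hom x := by
  simp only [chainD, ModuleCat.hom_sum, ModuleCat.hom_zsmul, LinearMap.sum_apply,
    LinearMap.smul_apply]

theorem cochainD_apply (Y : CocyclicModule k) (n : ℕ) (y : Y.obj ⟨n⟩) :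
    (cochainD Y n).hom y = ∑ j : Fin (n + 2), (-1 : ℤ) ^ (j : ℕ) • (Y.map (coface j)).hom y := by
  simp only [cochainD, ModuleCat.hom_sum, ModuleCat.hom_zsmul, LinearMap.sum_apply,
    LinearMap.smul_apply]

theorem chainD_naturality {X X' : CyclicModule k} (φ : X ⟶ X') (n : ℕ) :
    chainD X n ≫ φ.app (op ⟨n⟩) = φ.app (op ⟨n + 1⟩) ≫ chainD X' n := by
  simp only [chainD, Preadditive.sum_comp, Preadditive.comp_sum, Preadditive.zsmul_comp,
    Preadditive.comp_zsmul, φ.naturality]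

theorem cochainD_naturality {Y Y' : CocyclicModule k} (φ : Y ⟶ Y') (n : ℕ) :
    cochainD Y n ≫ φ.app ⟨n + 1⟩ = φ.app ⟨n⟩ ≫ cochainD Y' n := by
  simp only [cochainD, Preadditive.sum_comp, Preadditive.comp_sum, Preadditive.zsmul_comp,
    Preadditive.comp_zsmul, φ.naturality]

/-- The signed cyclic operator `(-1)^n τ_n` on `X_n`. -/
def chainCyc (X : CyclicModule k) (n : ℕ) : X.obj (op ⟨n⟩) →ₗ[k] X.obj (op ⟨n⟩) :=
  (-1 : ℤ) ^ n • (X.map (tau ⟨n⟩).op).hom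

/-- The signed cyclic operator `(-1)^n τ_n` on `Y_n`. -/
def cochainCyc (Y : CocyclicModule k) (n : ℕ) : Y.obj ⟨n⟩ →ₗ[k] Y.obj ⟨n⟩ :=
  (-1 : ℤ) ^ n • (Y.map (tau ⟨n⟩)).hom

/-- The image of `1 - (-1)^n τ_n` in `X_n`. -/
def chainRel (X : CyclicModule k) (n : ℕ) : Submodule k (X.obj (op ⟨n⟩)) :=
  LinearMap.range (LinearMap.id - chainCyc X n)

/-- The cyclic invariants in `Y_n`, i.e. the kernel of `1 - (-1)^n τ_n`. -/
def cochainInv (Y : CocyclicModule k) (n : ℕ) : Submodule k (Y.obj ⟨n⟩) :=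
  LinearMap.ker (LinearMap.id - cochainCyc Y n)

theorem chainRel_le_comap (X : CyclicModule k) (n : ℕ) :
    chainRel X (n + 1) ≤ (chainRel X n).comap (chainD X n).hom := by
  rintro _ ⟨x, rfl⟩
  refine ⟨∑ i : Fin (n + 1), (-1 : ℤ) ^ (i : ℕ) • (X.map (coface i.castSucc).op).hom x, ?_⟩
  have h0 : (X.map (coface (0 : Fin (n + 2))).op).hom ((X.map (tau ⟨n + 1⟩).op).hom x) =
      (X.map (coface (Fin.last (n + 1))).op).hom x := by
    rw [← coface_zero_tau, op_comp, X.map_comp]; rfl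
  have h1 (i : Fin (n + 1)) :
      (X.map (coface i.succ).op).hom ((X.map (tau ⟨n + 1⟩).op).hom x) =
      (X.map (tau ⟨n⟩).op).hom ((X.map (coface i.castSucc).op).hom x) := by
    have h := congrArg (fun f => (X.map f.op).hom x) (coface_succ_tau i)
    simpa only [op_comp, X.map_comp, ModuleCat.hom_comp, LinearMap.comp_apply] using h
  have hx := (chainD_apply X n x).trans (Fin.sum_univ_castSucc _)
  have hT := (chainD_apply X n ((X.map (tau ⟨n + 1⟩).op).hom x)).trans (Fin.sum_univ_succ _)
  simp only [chainCyc, LinearMap.sub_apply, LinearMap.id_apply, LinearMap.smul_apply, map_sub,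
    map_zsmul]
  rw [hx, hT, h0]
  simp only [h1, map_sum, map_zsmul, Finset.smul_sum, smul_add, smul_smul, Fin.val_castSucc,
    Fin.val_succ, Fin.val_last, Fin.val_zero, pow_zero, one_smul]
  have hs (i : ℕ) : (-1 : ℤ) ^ (n + 1) * (-1) ^ (i + 1) = (-1) ^ n * (-1) ^ i := by
    rw [pow_succ, pow_succ]; ring
  simp only [hs]
  abel

theorem cochainInv_le_comap (Y : CocyclicModule k) (n : ℕ) :
    cochainInv Y n ≤ (cochainInv Y (n + 1)).comap (cochainD Y n).hom := by
  intro y hy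
  have hy' : y - (-1 : ℤ) ^ n • (Y.map (tau ⟨n⟩)).hom y = 0 := hy
  have hy'' : (Y.map (tau ⟨n⟩)).hom y = (-1 : ℤ) ^ n • y := by
    nth_rewrite 2 [sub_eq_zero.1 hy']
    rw [smul_smul, ← mul_pow]
    simp
  have h0 : (Y.map (tau ⟨n + 1⟩)).hom ((Y.map (coface (0 : Fin (n + 2)))).hom y) =
      (Y.map (coface (Fin.last (n + 1)))).hom y := by
    rw [← coface_zero_tau, Y.map_comp]; rfl
  have h1 (i : Fin (n + 1)) :
      (Y.map (tau ⟨n + 1⟩)).hom ((Y.map (coface i.succ)).hom y) =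
      (-1 : ℤ) ^ n • (Y.map (coface i.castSucc)).hom y := by
    have h := congrArg (fun f => (Y.map f).hom y) (coface_succ_tau i)
    simp only [Y.map_comp, ModuleCat.hom_comp, LinearMap.comp_apply] at h
    rw [h, hy'', map_zsmul]
  change (cochainD Y n).hom y - (-1 : ℤ) ^ (n + 1) •
    (Y.map (tau ⟨n + 1⟩)).hom ((cochainD Y n).hom y) = 0
  have hL := (cochainD_apply Y n y).trans (Fin.sum_univ_castSucc _)
  have hR := (cochainD_apply Y n y).trans (Fin.sum_univ_succ _)
  rw [sub_eq_zero]
  nth_rewrite 1 [hL]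
  rw [hR]
  simp only [map_add, map_sum, map_zsmul, h0, h1, Finset.smul_sum, smul_add, smul_smul,
    Fin.val_castSucc, Fin.val_succ, Fin.val_last, Fin.val_zero, pow_zero, one_smul]
  have hs (l : ℕ) : (-1 : ℤ) ^ (n + 1) * ((-1) ^ (l + 1) * (-1) ^ n) = (-1) ^ l := by
    have : ((-1 : ℤ) ^ n) * (-1) ^ n = 1 := by rw [← mul_pow]; simp
    rw [pow_succ, pow_succ]
    linear_combination (-1 : ℤ) ^ l * this
  simp only [hs]
  abel

theorem chainRel_map {X X' : CyclicModule k} (φ : X ⟶ X') (n : ℕ) :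
    chainRel X n ≤ (chainRel X' n).comap (φ.app (op ⟨n⟩)).hom := by
  rintro _ ⟨x, rfl⟩
  refine ⟨(φ.app (op ⟨n⟩)).hom x, ?_⟩
  have h := congrArg (fun f => f.hom x) (φ.naturality (tau ⟨n⟩).op)
  simp only [ModuleCat.hom_comp, LinearMap.comp_apply] at h
  simp only [chainCyc, LinearMap.sub_apply, LinearMap.id_apply, LinearMap.smul_apply, map_sub,
    map_zsmul, h]

theorem cochainInv_map {Y Y' : CocyclicModule k} (φ : Y ⟶ Y') (n : ℕ) :
    cochainInv Y n ≤ (cochainInv Y' n).comap (φ.app ⟨n⟩).hom := by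
  intro y hy
  have hy' : y - (-1 : ℤ) ^ n • (Y.map (tau ⟨n⟩)).hom y = 0 := hy
  change (φ.app ⟨n⟩).hom y - (-1 : ℤ) ^ n • (Y'.map (tau ⟨n⟩)).hom ((φ.app ⟨n⟩).hom y) = 0
  have h := congrArg (fun f => f.hom y) (φ.naturality (tau ⟨n⟩))
  simp only [ModuleCat.hom_comp, LinearMap.comp_apply] at h
  rw [← h, ← map_zsmul, ← map_sub, hy', map_zero]

/-- The functor sending a cyclic module `X` to `CH^λ_*(X)`, the quotient of its Hochschild
complex by the image of `1 - (-1)^n τ_n` in each degree `n`. -/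
def cyclicChain : CyclicModule k ⥤ ChainComplex (ModuleCat.{u} k) ℕ where
  obj X := ChainComplex.of (fun n => ModuleCat.of k (X.obj (op ⟨n⟩) ⧸ chainRel X n))
    (fun n => ModuleCat.ofHom (Submodule.mapQ _ _ (chainD X n).hom (chainRel_le_comap X n)))
    (fun n => by
      rw [← ModuleCat.ofHom_comp, ← Submodule.mapQ_comp]
      have h : (chainD X n).hom ∘ₗ (chainD X (n + 1)).hom = 0 := by
        rw [← ModuleCat.hom_comp, chainD_comp]; rfl
      simp only [h, Submodule.mapQ_zero]
      rfl)
  map {X X'} φ := ChainComplex.ofHom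
    (fun n => ModuleCat.ofHom (Submodule.mapQ _ _ (φ.app (op ⟨n⟩)).hom (chainRel_map φ n)))
    (fun n => by
      simp only [ChainComplex.of_d]
      rw [← ModuleCat.ofHom_comp, ← ModuleCat.ofHom_comp, ← Submodule.mapQ_comp,
        ← Submodule.mapQ_comp]
      simp only [← ModuleCat.hom_comp, chainD_naturality])
  map_id X := by
    ext n : 1
    exact congrArg ModuleCat.ofHom (Submodule.mapQ_id _)
  map_comp φ ψ := by
    ext n : 1
    exact (congrArg ModuleCat.ofHom (Submodule.mapQ_comp _ _ _ _ _ (chainRel_map φ n)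
      (chainRel_map ψ n))).trans (ModuleCat.ofHom_comp _ _)

/-- The functor sending a cocyclic module `Y` to `CH_λ^*(Y)`, the subcomplex of its Hochschild
complex consisting of the `y ∈ Y_n` with `(-1)^n τ_n y = y`. -/
def cyclicCochain : CocyclicModule k ⥤ CochainComplex (ModuleCat.{u} k) ℕ where
  obj Y := CochainComplex.of (fun n => ModuleCat.of k (cochainInv Y n))
    (fun n => ModuleCat.ofHom ((cochainD Y n).hom.restrict (cochainInv_le_comap Y n)))
    (fun n => by
      ext y : 3
      exact congrArg (fun f => f.hom (y : Y.obj ⟨n⟩)) (cochainD_comp Y n))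
  map {Y Y'} φ := CochainComplex.ofHom
    (fun n => ModuleCat.ofHom ((φ.app ⟨n⟩).hom.restrict (cochainInv_map φ n)))
    (fun n => by
      simp only [CochainComplex.of_d]
      ext y : 3
      exact (congrArg (fun f => f.hom (y : Y.obj ⟨n⟩)) (cochainD_naturality φ n)).symm)
  map_id Y := by
    ext n : 1
    rfl
  map_comp φ ψ := by
    ext n : 1
    rfl

/-- The functor `HC^λ_n`: the homology of the cyclic coinvariant quotient complex. -/
def cyclicHomology (k : Type u) [Field k] (n : ℕ) : CyclicModule k ⥤ ModuleCat.{u} k :=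
  cyclicChain ⋙ HomologicalComplex.homologyFunctor _ _ n

/-- The functor `HC_λ^n`: the cohomology of the cyclic invariant subcomplex. -/
def cyclicCohomology (k : Type u) [Field k] (n : ℕ) : CocyclicModule k ⥤ ModuleCat.{u} k :=
  cyclicCochain ⋙ HomologicalComplex.homologyFunctor _ _ n

end ConnesCyclic

end

/-! In characteristic zero the relative theory collapses to the absolute one. The category `T` is a
disjoint union of finite cyclic groups, so averaging makes every epimorphism of `T`-modules split
(`isSplitEpi_of_epi_rot`). Hence `(Λ, T)`-epimorphisms are epimorphisms, `(Λ, T)`-projectives are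
projectives, and any two relative resolutions of the trivial module are homotopy equivalent. One
well-chosen resolution therefore suffices, because homotopy equivalences survive `X ⊗_Λ -` and
`Hom_Λ(-, Y)`, naturally in `X` and `Y`.

The choice is `P_n(c) = k[Λ([n], c)]` modulo the image of `1 - (-1)^n τ_n`, with the Hochschild
differential (`cyclicResolution`). By Yoneda, `Hom_Λ(P_n, Y)` is the module of cyclic invariants of
`Y_n` (`homEquiv`), and dually `X ⊗_Λ P_n` is the module of cyclic coinvariants of `X_n`
(`tensorEquiv`). The differentials match, so these complexes are Connes' complexes. Invariants of a
finite group are exact in characteristic zero, so `P_n` is projective.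

Exactness holds over any field. Every morphism `[n] ⟶ [m]` of `Λ` is uniquely a rotation of `[n]`
followed by an order-preserving map. Passing to signed coinvariants removes the rotation, so
`P_*([m])` is the unnormalised simplicial chain complex of the `m`-simplex. The cone on the vertex
`0` contracts it onto `k` (`d_coneMap_add`, `d_coneMap_zero`). The work lies in checking that this
cone, with the sign of the rotation, is well defined on coinvariants. -/

noncomputable section

/-! ### Relative resolutions as absolute ones -/

namespace RelativeHomology

open Limits

/-- A sequence of functors to an abelian category is exact if it is so at each object. -/
theorem exact_of_exact_app {C A : Type*} [Category C] [Category A] [Abelian A]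
    {S : ShortComplex (C ⥤ A)} (h : ∀ c, (S.map ((evaluation C A).obj c)).Exact) : S.Exact := by
  rw [ShortComplex.exact_iff_isZero_homology, Functor.isZero_iff]
  intro c
  exact ((ShortComplex.exact_iff_isZero_homology _).1 (h c)).of_iso
    (S.mapHomologyIso ((evaluation C A).obj c)).symm

/-- A complex of projectives which is exact over `Z` is a projective resolution of `Z`. -/
def projectiveResolutionOfExact {A : Type*} [Category A] [Abelian A] {Z : A}
    (K : ChainComplex A ℕ) (hK : ∀ n, Projective (K.X n)) (p : K.X 0 ⟶ Z) [Epi p]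
    (w : K.d 1 0 ≫ p = 0) (h0 : (ShortComplex.mk _ _ w).Exact)
    (hs : ∀ n, (ShortComplex.mk _ _ (K.d_comp_d (n + 2) (n + 1) n)).Exact) :
    ProjectiveResolution Z where
  complex := K
  projective := hK
  π := (ChainComplex.toSingle₀Equiv _ _).symm ⟨p, w⟩
  quasiIso := ⟨fun n => by
    -- In degree zero a quasi-isomorphism to `Z` means exactness of `K_1 → K_0 → Z → 0`; in positive
    -- degrees the target is zero and the source must be exact.
    cases n
    · rw [ChainComplex.quasiIsoAt₀_iff, ShortComplex.quasiIso_iff_of_zeros']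
      · refine (ShortComplex.exact_and_epi_g_iff_of_iso ?_).2 ⟨h0, by dsimp; infer_instance⟩
        exact ShortComplex.isoMk (Iso.refl _) (Iso.refl _) (Iso.refl _)
          ((Category.id_comp _).trans (Category.comp_id _).symm)
          (by
            change 𝟙 (K.X 0) ≫ p = ((ChainComplex.toSingle₀Equiv K Z).symm ⟨p, w⟩).f 0 ≫ 𝟙 Z
            rw [ChainComplex.toSingle₀Equiv_symm_apply_f_zero]
            exact (Category.id_comp p).trans (Category.comp_id p).symm)
      · exact K.shape _ _ (by simp)
      all_goals rfl
    · rename_i n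
      rw [quasiIsoAt_iff_exactAt']
      · rw [HomologicalComplex.exactAt_iff' _ (n + 2) (n + 1) n (by simp) (by simp)]
        exact hs n
      · apply ChainComplex.exactAt_succ_single_obj⟩

section

variable {k : Type u} [Field k] {C S : Type} [Category.{0} C] [Category.{0} S]

/-- Epimorphisms of functors to modules are detected objectwise, so restriction along `ι` preserves
them, and `hι` then supplies the splitting. -/
theorem isRelEpi_iff {ι : S ⥤ C}
    (hι : ∀ {X Y : S ⥤ ModuleCat.{u} k} (f : X ⟶ Y), Epi f → IsSplitEpi f)
    {X Y : C ⥤ ModuleCat.{u} k} (f : X ⟶ Y) : IsRelEpi ι f ↔ Epi f :=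
  ⟨fun h => h.1, fun h => ⟨h, hι _ (by
    rw [NatTrans.epi_iff_epi_app] at h ⊢
    exact fun c => h (ι.obj c))⟩⟩

theorem isRelProjective_iff {ι : S ⥤ C}
    (hι : ∀ {X Y : S ⥤ ModuleCat.{u} k} (f : X ⟶ Y), Epi f → IsSplitEpi f)
    (P : C ⥤ ModuleCat.{u} k) : IsRelProjective ι P ↔ Projective P :=
  ⟨fun h => ⟨fun p f _ => h f ((isRelEpi_iff hι f).2 inferInstance) p⟩, fun _ _ _ f hf p =>
    have := hf.1
    ⟨Projective.factorThru p f, Projective.factorThru_comp p f⟩⟩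

/-- If all epimorphisms of `S`-modules split, relative projective resolutions are projective
resolutions. -/
def RelProjectiveResolution.toProjectiveResolution {ι : S ⥤ C}
    (hι : ∀ {X Y : S ⥤ ModuleCat.{u} k} (f : X ⟶ Y), Epi f → IsSplitEpi f)
    {M : C ⥤ ModuleCat.{u} k} (P : RelProjectiveResolution ι M) : ProjectiveResolution M :=
  have := P.relEpi_aug.1
  projectiveResolutionOfExact P.complex (fun n => (isRelProjective_iff hι _).1 (P.projective n))
    P.aug P.d_comp_aug ((ShortComplex.exact_iff_epi_kernel_lift _).2 P.relEpi_zero.1)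
    (fun n => (ShortComplex.exact_iff_epi_kernel_lift _).2 (P.relEpi_succ n).1)

/-- If all epimorphisms of `S`-modules split, exact complexes of projectives are relative
projective resolutions. -/
def RelProjectiveResolution.ofExact {ι : S ⥤ C}
    (hι : ∀ {X Y : S ⥤ ModuleCat.{u} k} (f : X ⟶ Y), Epi f → IsSplitEpi f)
    {M : C ⥤ ModuleCat.{u} k} (K : ChainComplex (C ⥤ ModuleCat.{u} k) ℕ)
    (hK : ∀ n, Projective (K.X n)) (p : K.X 0 ⟶ M) (hp : Epi p)
    (w : K.d 1 0 ≫ p = 0) (h0 : (ShortComplex.mk _ _ w).Exact)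
    (hs : ∀ n, (ShortComplex.mk _ _ (K.d_comp_d (n + 2) (n + 1) n)).Exact) :
    RelProjectiveResolution ι M where
  complex := K
  aug := p
  d_comp_aug := w
  projective n := (isRelProjective_iff hι _).2 (hK n)
  relEpi_aug := (isRelEpi_iff hι _).2 hp
  relEpi_zero := (isRelEpi_iff hι _).2 ((ShortComplex.exact_iff_epi_kernel_lift _).1 h0)
  relEpi_succ n := (isRelEpi_iff hι _).2 ((ShortComplex.exact_iff_epi_kernel_lift _).1 (hs n))

/-! #### Homotopy invariance -/

theorem tensorMap_add {X X' : Cᵒᵖ ⥤ ModuleCat.{u} k} {P P' : C ⥤ ModuleCat.{u} k}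
    (φ : X ⟶ X') (ψ ψ' : P ⟶ P') :
    tensorMap φ (ψ + ψ') = tensorMap φ ψ + tensorMap φ ψ' :=
  tensor_hom_ext fun c x p => by
    classical
    rw [LinearMap.add_apply, tensorMap_mk, tensorMap_mk, tensorMap_mk, ← Submodule.Quotient.mk_add,
      ← map_add, ← TensorProduct.tmul_add]
    rfl

/-- The functor `P ↦ X ⊗_C P`. -/
def tensorFunctor (X : Cᵒᵖ ⥤ ModuleCat.{u} k) : (C ⥤ ModuleCat.{u} k) ⥤ ModuleCat.{u} k where
  obj P := ModuleCat.of k (Tensor X P)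
  map ψ := ModuleCat.ofHom (tensorMap (𝟙 X) ψ)
  map_id P := congrArg ModuleCat.ofHom (tensorMap_id X P)
  map_comp ψ ψ' := by
    rw [← ModuleCat.ofHom_comp, ← tensorMap_comp, Category.comp_id]

instance (X : Cᵒᵖ ⥤ ModuleCat.{u} k) : (tensorFunctor X).Additive where
  map_add {_ _ ψ ψ'} := congrArg ModuleCat.ofHom (tensorMap_add (𝟙 X) ψ ψ')

/-- Functoriality of `X ⊗_C P_*` in `P_*`. -/
def tensorComplexMap {P Q : ChainComplex (C ⥤ ModuleCat.{u} k) ℕ} (ψ : P ⟶ Q) :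
    tensorComplex P ⟶ tensorComplex Q where
  app X := ((tensorFunctor X).mapHomologicalComplex _).map ψ
  naturality X X' φ := by
    ext n : 1
    change ModuleCat.ofHom (tensorMap φ (𝟙 (P.X n))) ≫ ModuleCat.ofHom (tensorMap (𝟙 X') (ψ.f n)) =
      ModuleCat.ofHom (tensorMap (𝟙 X) (ψ.f n)) ≫ ModuleCat.ofHom (tensorMap φ (𝟙 (Q.X n)))
    rw [← ModuleCat.ofHom_comp, ← ModuleCat.ofHom_comp, ← tensorMap_comp, ← tensorMap_comp]
    simp only [Category.comp_id, Category.id_comp]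

/-- Functoriality of `Hom_C(P_*, Y)` in `P_*`. -/
def homComplexMap {P Q : ChainComplex (C ⥤ ModuleCat.{u} k) ℕ} (ψ : P ⟶ Q) :
    homComplex Q ⟶ homComplex P where
  app Y :=
    { f := fun n => ModuleCat.ofHom (Linear.leftComp k Y (ψ.f n))
      comm' := fun i j _ => by
        have key (f : Q.X i ⟶ Y) : P.d j i ≫ ψ.f i ≫ f = ψ.f j ≫ Q.d j i ≫ f := by
          rw [← Category.assoc, ← Category.assoc, ψ.comm]
        ext f : 2
        exact key f }
  naturality Y Y' φ := by
    ext n f : 3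
    exact (Category.assoc (W := P.X n) (ψ.f n) f φ).symm

/-- Precomposition with a map `P_j ⟶ Q_i`. -/
def homComplexPrecomp {P Q : ChainComplex (C ⥤ ModuleCat.{u} k) ℕ} (Y : C ⥤ ModuleCat.{u} k)
    {i j : ℕ} (g : P.X j ⟶ Q.X i) : ((homComplex Q).obj Y).X i ⟶ ((homComplex P).obj Y).X j :=
  ModuleCat.ofHom (Linear.leftComp k Y g)

/-- Homotopic maps `P_* ⟶ Q_*` induce homotopic maps `Hom_C(Q_*, Y) ⟶ Hom_C(P_*, Y)`. -/
def homComplexHomotopy {P Q : ChainComplex (C ⥤ ModuleCat.{u} k) ℕ} {ψ ψ' : P ⟶ Q}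
    (h : Homotopy ψ ψ') (Y : C ⥤ ModuleCat.{u} k) :
    Homotopy ((homComplexMap ψ).app Y) ((homComplexMap ψ').app Y) where
  hom i j := homComplexPrecomp Y (h.hom j i)
  zero i j hij := by
    have key (f : Q.X i ⟶ Y) : h.hom j i ≫ f = 0 := by
      rw [h.zero j i hij, zero_comp]
    ext f : 2
    exact key f
  comm n := by
    have hn := h.comm n
    -- Reversing the arrows exchanges the two terms of the homotopy relation, and in degree zero
    -- only one of them survives.
    rcases n with _ | n
    · rw [Homotopy.prevD_chainComplex, Homotopy.dNext_zero_chainComplex, zero_add] at hn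
      rw [Homotopy.prevD_zero_cochainComplex, Homotopy.dNext_cochainComplex]
      have key (f : Q.X 0 ⟶ Y) :
          ψ.f 0 ≫ f = h.hom 0 1 ≫ Q.d 1 0 ≫ f + 0 + ψ'.f 0 ≫ f := by
        rw [hn, Preadditive.add_comp, Category.assoc, add_zero]
      ext f : 2
      exact key f
    · rw [Homotopy.prevD_chainComplex, Homotopy.dNext_succ_chainComplex] at hn
      rw [Homotopy.prevD_succ_cochainComplex, Homotopy.dNext_cochainComplex]
      have key (f : Q.X (n + 1) ⟶ Y) :
          ψ.f (n + 1) ≫ f = h.hom (n + 1) (n + 2) ≫ Q.d (n + 2) (n + 1) ≫ f +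
            P.d (n + 1) n ≫ h.hom n (n + 1) ≫ f + ψ'.f (n + 1) ≫ f := by
        rw [hn, Preadditive.add_comp, Preadditive.add_comp, Category.assoc, Category.assoc,
          add_comm (P.d (n + 1) n ≫ _)]
      ext f : 2
      exact key f

/-- A homotopy equivalence `P_* ≃ Q_*` induces homotopy equivalences
`Hom_C(Q_*, Y) ≃ Hom_C(P_*, Y)`. -/
def homComplexHomotopyEquiv {P Q : ChainComplex (C ⥤ ModuleCat.{u} k) ℕ}
    (e : HomotopyEquiv P Q) (Y : C ⥤ ModuleCat.{u} k) :
    HomotopyEquiv ((homComplex Q).obj Y) ((homComplex P).obj Y) where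
  hom := (homComplexMap e.hom).app Y
  inv := (homComplexMap e.inv).app Y
  homotopyHomInvId := (Homotopy.ofEq (by
      ext n f : 3
      exact (Category.assoc (W := Q.X n) (e.inv.f n) (e.hom.f n) f).symm)).trans
    ((homComplexHomotopy e.homotopyInvHomId Y).trans (Homotopy.ofEq (by
      ext n f : 3
      exact Category.id_comp (X := Q.X n) f)))
  homotopyInvHomId := (Homotopy.ofEq (by
      ext n f : 3
      exact (Category.assoc (W := P.X n) (e.hom.f n) (e.inv.f n) f).symm)).trans
    ((homComplexHomotopy e.homotopyHomInvId Y).trans (Homotopy.ofEq (by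
      ext n f : 3
      exact Category.id_comp (X := P.X n) f)))

/-- Homotopy equivalent complexes define the same homology of `X ⊗_C P_*`. -/
def tensorHomologyIso {P Q : ChainComplex (C ⥤ ModuleCat.{u} k) ℕ} (e : HomotopyEquiv P Q)
    (n : ℕ) : tensorComplex P ⋙ HomologicalComplex.homologyFunctor _ _ n ≅
      tensorComplex Q ⋙ HomologicalComplex.homologyFunctor _ _ n :=
  NatIso.ofComponents
    (fun X => ((tensorFunctor X).mapHomotopyEquiv e).toHomologyIso n)
    -- Each component is the map on homology induced by `tensorComplexMap e.hom`, which is already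
    -- natural in `X`.
    (fun φ => (Functor.whiskerRight (tensorComplexMap e.hom)
      (HomologicalComplex.homologyFunctor _ _ n)).naturality φ)

/-- Homotopy equivalent complexes define the same cohomology of `Hom_C(P_*, Y)`. -/
def homCohomologyIso {P Q : ChainComplex (C ⥤ ModuleCat.{u} k) ℕ} (e : HomotopyEquiv P Q)
    (n : ℕ) : homComplex Q ⋙ HomologicalComplex.homologyFunctor _ _ n ≅
      homComplex P ⋙ HomologicalComplex.homologyFunctor _ _ n :=
  NatIso.ofComponents
    (fun Y => (homComplexHomotopyEquiv e Y).toHomologyIso n)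
    (fun φ => (Functor.whiskerRight (homComplexMap e.hom)
      (HomologicalComplex.homologyFunctor _ _ n)).naturality φ)

end

end RelativeHomology

/-! ### Averaging over cyclic groups and splitting of `T`-modules -/

namespace ConnesCyclic

/-- Equivariant sections of a surjection of representations of a finite cyclic group exist in
characteristic zero. -/
theorem exists_equivariant_section {k V W : Type*} [Field k] [CharZero k] [AddCommGroup V]
    [Module k V] [AddCommGroup W] [Module k W] {n : ℕ} {T : Module.End k V} {U : Module.End k W}
    (hT : T ^ (n + 1) = 1) (hU : U ^ (n + 1) = 1) {p : V →ₗ[k] W} (hp : Function.Surjective p)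
    (h : p ∘ₗ T = U ∘ₗ p) :
    ∃ s : W →ₗ[k] V, p ∘ₗ s = LinearMap.id ∧ T ∘ₗ s = s ∘ₗ U := by
  obtain ⟨s, hs⟩ := p.exists_rightInverse_of_surjective (LinearMap.range_eq_top.2 hp)
  have hpT (i : ℕ) (v : V) : p ((T ^ i) v) = (U ^ i) (p v) := by
    induction i with
    | zero => rfl
    | succ i ih =>
      rw [pow_succ', pow_succ', Module.End.mul_apply, Module.End.mul_apply, ← ih]
      exact LinearMap.congr_fun h _
  have hU' (i j : ℕ) : U ^ (i + j * (n + 1)) = U ^ i := by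
    rw [pow_add, mul_comm j, pow_mul, hU, one_pow, mul_one]
  have hn : ((n : k) + 1) ≠ 0 := by exact_mod_cast n.succ_ne_zero
  let t (i : ℕ) : W →ₗ[k] V := (T ^ i) ∘ₗ s ∘ₗ (U ^ (n * i))
  have ht (i : ℕ) : T ∘ₗ t i = t (i + 1) ∘ₗ U := by
    ext w
    have : U ^ (n * (i + 1)) * U = U ^ (n * i) := by
      rw [← pow_succ, ← hU' (n * i) 1]
      congr 1
      ring
    change T ((T ^ i) (s ((U ^ (n * i)) w))) = (T ^ (i + 1)) (s ((U ^ (n * (i + 1)) * U) w))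
    rw [this, pow_succ']
    rfl
  have ht' : t (n + 1) = t 0 := by
    have : U ^ (n * (n + 1)) = 1 := by rw [mul_comm, pow_mul, hU, one_pow]
    simp [t, hT, this]
  refine ⟨((n : k) + 1)⁻¹ • ∑ i ∈ Finset.range (n + 1), t i, ?_, ?_⟩
  · ext w
    have hw (i : ℕ) : p (t i w) = w := by
      change p ((T ^ i) (s ((U ^ (n * i)) w))) = w
      rw [hpT]
      have h1 : p (s ((U ^ (n * i)) w)) = (U ^ (n * i)) w := LinearMap.congr_fun hs _
      rw [h1, ← Module.End.mul_apply, ← pow_add, show i + n * i = 0 + i * (n + 1) by ring, hU']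
      rfl
    simp only [LinearMap.comp_apply, LinearMap.smul_apply, LinearMap.sum_apply, map_smul, map_sum,
      hw, Finset.sum_const, Finset.card_range, LinearMap.id_apply]
    rw [← Nat.cast_smul_eq_nsmul k, smul_smul, Nat.cast_succ, inv_mul_cancel₀ hn, one_smul]
  · rw [LinearMap.comp_smul, LinearMap.smul_comp]
    rw [show T ∘ₗ (∑ i ∈ Finset.range (n + 1), t i) = ∑ i ∈ Finset.range (n + 1), T ∘ₗ t i by
      ext; simp, show (∑ i ∈ Finset.range (n + 1), t i) ∘ₗ U =
      ∑ i ∈ Finset.range (n + 1), t i ∘ₗ U by ext; simp]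
    congr 1
    -- Conjugation by the generator shifts the index by one, and `t (n + 1) = t 0` closes the cycle.
    simp only [ht]
    rw [Finset.sum_range_succ, ht', Finset.sum_range_succ', add_comm]

/-- The class of `x ↦ x + i`. -/
def rot (a : Lam) (i : ℤ) : a ⟶ a :=
  Lam.mkHom ⟨fun x => x + i, fun _ _ h => by simpa using h, fun _ => by ring⟩

theorem tau_pow (a : Lam) (i : ℕ) : (show End a from tau a) ^ i = rot a (-i) := by
  induction i with
  | zero =>
    refine Lam.mkHom_eq fun x => ?_
    change x + -((0 : ℕ) : ℤ) = x
    simp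
  | succ i ih =>
    rw [pow_succ, ih]
    change tau a ≫ rot a (-i) = _
    refine Lam.mkHom_eq fun x => ?_
    change x + -((i + 1 : ℕ) : ℤ) = x - 1 + -i
    push_cast
    ring

theorem tau_pow_period (a : Lam) : (show End a from tau a) ^ (a.len + 1) = 1 := by
  rw [tau_pow]
  -- The power is translation by minus one full period, hence one period away from the identity.
  refine Quotient.sound ⟨1, fun x => ?_⟩
  change x = x + -((a.len + 1 : ℕ) : ℤ) + 1 * (a.len + 1)
  push_cast
  ring

theorem hom_map_pow {k : Type u} [Field k] {C : Type*} [Category C] (F : C ⥤ ModuleCat.{u} k)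
    {c : C} (f : c ⟶ c) (n : ℕ) :
    (F.map f).hom ^ n = (F.map ((show End c from f) ^ n)).hom := by
  induction n with
  | zero =>
    rw [pow_zero, pow_zero]
    change _ = (F.map (𝟙 c)).hom
    rw [F.map_id]
    rfl
  | succ n ih =>
    rw [pow_succ, pow_succ, ih]
    change _ = (F.map (f ≫ _)).hom
    rw [F.map_comp]
    rfl

/-- The accumulated sign is `(-1)^(n(n+1)) = 1`, so the signed operator still generates an action of
the cyclic group of order `n + 1`. -/
theorem cochainCyc_pow {k : Type u} [Field k] (Y : CocyclicModule k) (n : ℕ) :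
    (show Module.End k (Y.obj ⟨n⟩) from cochainCyc Y n) ^ (n + 1) = 1 := by
  change ((-1 : ℤ) ^ n • (Y.map (tau ⟨n⟩)).hom) ^ (n + 1) = 1
  rw [smul_pow, hom_map_pow, tau_pow_period ⟨n⟩, ← pow_mul,
    Even.neg_one_pow (Nat.even_mul_succ_self n), one_smul]
  change (Y.map (𝟙 _)).hom = _
  rw [Y.map_id]
  rfl

/-- The operator `τ_n` as a morphism of `T`. -/
def rotTau (a : Rot) : a ⟶ a :=
  ⟨tau a.obj, .of _ ⟨a.obj⟩⟩

theorem rotTau_pow_period (a : Rot) : (show End a from rotTau a) ^ (a.obj.len + 1) = 1 := by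
  have (i : ℕ) : ((show End a from rotTau a) ^ i).1 = (show End a.obj from tau a.obj) ^ i := by
    induction i with
    | zero => rfl
    | succ i ih =>
      rw [pow_succ, pow_succ, ← ih]
      rfl
  exact WideSubcategory.hom_ext _ ((this _).trans (tau_pow_period a.obj))

/-- In characteristic zero all epimorphisms of `T`-modules split. -/
theorem isSplitEpi_of_epi_rot {k : Type u} [Field k] [CharZero k] {X Y : Rot ⥤ ModuleCat.{u} k}
    (f : X ⟶ Y) (hf : Epi f) : IsSplitEpi f := by
  have h (a : Rot) : ∃ s : Y.obj a →ₗ[k] X.obj a, (f.app a).hom ∘ₗ s = LinearMap.id ∧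
      (X.map (rotTau a)).hom ∘ₗ s = s ∘ₗ (Y.map (rotTau a)).hom := by
    have hper (Z : Rot ⥤ ModuleCat.{u} k) :
        (show Module.End k (Z.obj a) from (Z.map (rotTau a)).hom) ^ (a.obj.len + 1) = 1 := by
      rw [hom_map_pow, rotTau_pow_period]
      change (Z.map (𝟙 _)).hom = _
      rw [Z.map_id]
      rfl
    refine exists_equivariant_section (hper X) (hper Y)
      ((ModuleCat.epi_iff_surjective _).1 ((NatTrans.epi_iff_epi_app f).1 hf a)) ?_
    exact congrArg ModuleCat.Hom.hom (f.naturality (rotTau a))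
  choose s hs hs' using h
  -- The sections are chosen one object at a time and are equivariant only for `τ`. This is enough,
  -- since every morphism of `T` is a composite of such operators.
  have nat {x y : Lam} (g : x ⟶ y)
      (hg : (MorphismProperty.ofHoms tau).multiplicativeClosure g) :
      Y.map (⟨g, hg⟩ : WideSubcategory.mk x ⟶ ⟨y⟩) ≫ ModuleCat.ofHom (s ⟨y⟩) =
        ModuleCat.ofHom (s ⟨x⟩) ≫ X.map (⟨g, hg⟩ : WideSubcategory.mk x ⟶ ⟨y⟩) := by
    induction hg with
    | @of x y g hg =>
      obtain ⟨⟩ := hg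
      exact ModuleCat.hom_ext (hs' ⟨x⟩).symm
    | id x =>
      change Y.map (𝟙 (WideSubcategory.mk x)) ≫ _ = _ ≫ X.map (𝟙 (WideSubcategory.mk x))
      rw [Y.map_id, X.map_id, Category.id_comp, Category.comp_id]
    | @comp_of x y z g g' hg h' ih =>
      cases h'
      have e : (⟨g ≫ tau _, .comp_of g _ hg ⟨_⟩⟩ : WideSubcategory.mk x ⟶ ⟨_⟩) =
        (⟨g, hg⟩ : WideSubcategory.mk x ⟶ ⟨_⟩) ≫ rotTau ⟨_⟩ := rfl
      have hτ : Y.map (rotTau ⟨y⟩) ≫ ModuleCat.ofHom (s ⟨y⟩) =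
        ModuleCat.ofHom (s ⟨y⟩) ≫ X.map (rotTau ⟨y⟩) := ModuleCat.hom_ext (hs' ⟨y⟩).symm
      rw [e, Y.map_comp, X.map_comp]
      exact (Category.assoc _ _ _).trans ((congrArg (_ ≫ ·) hτ).trans
        ((Category.assoc _ _ _).symm.trans ((congrArg (· ≫ _) ih).trans (Category.assoc _ _ _))))
  refine ⟨⟨{ app := fun a => ModuleCat.ofHom (s a), naturality := fun a b g => nat g.1 g.2 }, ?_⟩⟩
  ext a : 2
  exact ModuleCat.hom_ext (hs a)

end ConnesCyclic

/-! ### Universal property of the tensor product over a category -/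

namespace RelativeHomology

variable {k : Type u} [Field k] {C : Type} [Category.{0} C]

open scoped Classical in
/-- The class of `x ⊗ p` in `X ⊗_C P`. -/
def pureTensor (X : Cᵒᵖ ⥤ ModuleCat.{u} k) (P : C ⥤ ModuleCat.{u} k) (c : C) :
    X.obj (op c) →ₗ[k] P.obj c →ₗ[k] Tensor X P :=
  (TensorProduct.mk k (X.obj (op c)) (P.obj c)).compr₂ ((balancing X P).mkQ ∘ₗ
    DirectSum.lof k C (fun c => X.obj (op c) ⊗[k] P.obj c) c)

theorem pureTensor_balanced (X : Cᵒᵖ ⥤ ModuleCat.{u} k) (P : C ⥤ ModuleCat.{u} k) {a b : C}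
    (f : a ⟶ b) (x : X.obj (op b)) (p : P.obj a) :
    pureTensor X P a ((X.map f.op).hom x) p = pureTensor X P b x ((P.map f).hom p) :=
  (Submodule.Quotient.eq _).2 (Submodule.subset_span ⟨a, b, f, x, p, rfl⟩)

theorem tensorMap_pureTensor {X X' : Cᵒᵖ ⥤ ModuleCat.{u} k} {P P' : C ⥤ ModuleCat.{u} k}
    (φ : X ⟶ X') (ψ : P ⟶ P') (c : C) (x : X.obj (op c)) (p : P.obj c) :
    tensorMap φ ψ (pureTensor X P c x p) =
      pureTensor X' P' c ((φ.app (op c)).hom x) ((ψ.app c).hom p) :=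
  tensorMap_mk φ ψ c x p

theorem tensor_ext {X : Cᵒᵖ ⥤ ModuleCat.{u} k} {P : C ⥤ ModuleCat.{u} k} {M : Type u}
    [AddCommGroup M] [Module k M] {f g : Tensor X P →ₗ[k] M}
    (h : ∀ (c : C) (x : X.obj (op c)) (p : P.obj c),
      f (pureTensor X P c x p) = g (pureTensor X P c x p)) : f = g :=
  tensor_hom_ext h

open scoped Classical in
/-- The map out of `X ⊗_C P` given by a balanced family of bilinear maps. -/
def tensorLift {X : Cᵒᵖ ⥤ ModuleCat.{u} k} {P : C ⥤ ModuleCat.{u} k} {M : Type u}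
    [AddCommGroup M] [Module k M] (β : ∀ c, X.obj (op c) →ₗ[k] P.obj c →ₗ[k] M)
    (hβ : ∀ {a b : C} (f : a ⟶ b) (x : X.obj (op b)) (p : P.obj a),
      β a ((X.map f.op).hom x) p = β b x ((P.map f).hom p)) : Tensor X P →ₗ[k] M :=
  (balancing X P).liftQ (DirectSum.toModule k C M fun c => TensorProduct.lift (β c)) (by
    rw [balancing, Submodule.span_le]
    rintro _ ⟨a, b, f, x, p, rfl⟩
    rw [SetLike.mem_coe, LinearMap.mem_ker, map_sub, sub_eq_zero]
    refine ((DirectSum.toModule_lof (M := fun c => X.obj (op c) ⊗[k] P.obj c) k a _).trans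
      (TensorProduct.lift.tmul _ _)).trans ((hβ f x p).trans ?_)
    exact ((DirectSum.toModule_lof (M := fun c => X.obj (op c) ⊗[k] P.obj c) k b _).trans
      (TensorProduct.lift.tmul _ _)).symm)

theorem tensorLift_pureTensor {X : Cᵒᵖ ⥤ ModuleCat.{u} k} {P : C ⥤ ModuleCat.{u} k} {M : Type u}
    [AddCommGroup M] [Module k M] (β : ∀ c, X.obj (op c) →ₗ[k] P.obj c →ₗ[k] M)
    (hβ : ∀ {a b : C} (f : a ⟶ b) (x : X.obj (op b)) (p : P.obj a),
      β a ((X.map f.op).hom x) p = β b x ((P.map f).hom p)) (c : C) (x : X.obj (op c))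
    (p : P.obj c) : tensorLift β hβ (pureTensor X P c x p) = β c x p := by
  classical
  exact (DirectSum.toModule_lof (M := fun c => X.obj (op c) ⊗[k] P.obj c)
    (φ := fun c => TensorProduct.lift (β c)) k c (x ⊗ₜ[k] p)).trans (TensorProduct.lift.tmul x p)

/-- The complex of functors corresponding to a functor to complexes. -/
def complexOfFunctor {V : Type*} [Category V] [Preadditive V] (F : C ⥤ ChainComplex V ℕ) :
    ChainComplex (C ⥤ V) ℕ where
  X n := F ⋙ HomologicalComplex.eval _ _ n
  d i j :=
    { app := fun c => (F.obj c).d i j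
      naturality := fun _ _ f => (F.map f).comm i j }
  shape i j h := by
    ext c : 2
    exact (F.obj c).shape i j h
  d_comp_d' i j l _ _ := by
    ext c : 2
    exact (F.obj c).d_comp_d i j l

end RelativeHomology

/-! ### The canonical resolution: generators and relations -/

namespace ConnesCyclic

open RelativeHomology

variable (k : Type u) [Field k]

/-- The functor `c ↦ k[Λ(-, c)]`. -/
def linearYoneda : Lam ⥤ CyclicModule k where
  obj c :=
    { obj := fun n => ModuleCat.of k ((n.unop ⟶ c) →₀ k)
      map := fun f => ModuleCat.ofHom (Finsupp.lmapDomain k k fun g => f.unop ≫ g)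
      map_id := fun n => by
        refine ModuleCat.hom_ext (Finsupp.lhom_ext' fun g => LinearMap.ext_ring ?_)
        exact (Finsupp.mapDomain_single).trans (by rw [unop_id, Category.id_comp]; rfl)
      map_comp := fun f f' => by
        refine ModuleCat.hom_ext (Finsupp.lhom_ext' fun g => LinearMap.ext_ring ?_)
        refine (Finsupp.mapDomain_single).trans ?_
        refine Eq.trans ?_ (congrArg (Finsupp.mapDomain _) Finsupp.mapDomain_single.symm)
        refine Eq.trans ?_ Finsupp.mapDomain_single.symm
        rw [unop_comp, Category.assoc] }
  map u :=
    { app := fun n => ModuleCat.ofHom (Finsupp.lmapDomain k k fun g => g ≫ u)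
      naturality := fun n n' f => by
        refine ModuleCat.hom_ext (Finsupp.lhom_ext' fun g => LinearMap.ext_ring ?_)
        refine (congrArg (Finsupp.mapDomain _) Finsupp.mapDomain_single).trans ?_
        refine Eq.trans ?_ (congrArg (Finsupp.mapDomain _) Finsupp.mapDomain_single.symm)
        refine Finsupp.mapDomain_single.trans (Eq.trans ?_ Finsupp.mapDomain_single.symm)
        rw [Category.assoc] }
  map_id c := by
    ext n : 2
    refine ModuleCat.hom_ext (Finsupp.lhom_ext' fun g => LinearMap.ext_ring ?_)
    exact (Finsupp.mapDomain_single).trans (by rw [Category.comp_id]; rfl)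
  map_comp u v := by
    ext n : 2
    refine ModuleCat.hom_ext (Finsupp.lhom_ext' fun g => LinearMap.ext_ring ?_)
    refine (Finsupp.mapDomain_single).trans ?_
    refine Eq.trans ?_ (congrArg (Finsupp.mapDomain _) Finsupp.mapDomain_single.symm)
    refine Eq.trans ?_ Finsupp.mapDomain_single.symm
    rw [Category.assoc]

/-- The complex of left `Λ`-modules `CH^λ_*(k[Λ(-, c)])`. -/
def cyclicResolution : ChainComplex (CocyclicModule k) ℕ :=
  complexOfFunctor (linearYoneda k ⋙ cyclicChain)

variable {k}

theorem cyclicChain_d (X : CyclicModule k) (n : ℕ) : (cyclicChain.obj X).d (n + 1) n =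
    ModuleCat.ofHom (Submodule.mapQ _ _ (chainD X n).hom (chainRel_le_comap X n)) :=
  ChainComplex.of_d (fun n => ModuleCat.of k (X.obj (op ⟨n⟩) ⧸ chainRel X n))
    (fun n => ModuleCat.ofHom (Submodule.mapQ _ _ (chainD X n).hom (chainRel_le_comap X n))) n

theorem cyclicCochain_d (Y : CocyclicModule k) (n : ℕ) : (cyclicCochain.obj Y).d n (n + 1) =
    ModuleCat.ofHom ((cochainD Y n).hom.restrict (cochainInv_le_comap Y n)) :=
  CochainComplex.of_d (fun n => ModuleCat.of k (cochainInv Y n))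
    (fun n => ModuleCat.ofHom ((cochainD Y n).hom.restrict (cochainInv_le_comap Y n))) n

namespace cyclicResolution

variable {n : ℕ} {c : Lam}

/-- The basis element of `k[Λ([n], c)]` given by `g`. -/
def basisElt (g : Lam.mk n ⟶ c) : ((linearYoneda k).obj c).obj (op ⟨n⟩) :=
  (Finsupp.single g (1 : k) : (Lam.mk n ⟶ c) →₀ k)

theorem map_basisElt {m : ℕ} (f : Lam.mk m ⟶ Lam.mk n) (g : Lam.mk n ⟶ c) :
    (((linearYoneda k).obj c).map f.op).hom (basisElt g) = basisElt (f ≫ g) :=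
  Finsupp.mapDomain_single

theorem basisElt_ext {M : Type*} [AddCommGroup M] [Module k M]
    {f f' : ((linearYoneda k).obj c).obj (op ⟨n⟩) →ₗ[k] M}
    (h : ∀ g : Lam.mk n ⟶ c, f (basisElt g) = f' (basisElt g)) : f = f' :=
  Finsupp.lhom_ext' fun g => LinearMap.ext_ring (h g)

/-- The linear extension of a family indexed by `Λ([n], c)`. -/
def linearExtension {M : Type*} [AddCommGroup M] [Module k M] (φ : (Lam.mk n ⟶ c) → M) :
    ((linearYoneda k).obj c).obj (op ⟨n⟩) →ₗ[k] M :=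
  Finsupp.linearCombination k φ

theorem linearExtension_basisElt {M : Type*} [AddCommGroup M] [Module k M]
    (φ : (Lam.mk n ⟶ c) → M) (g : Lam.mk n ⟶ c) :
    linearExtension (k := k) φ (basisElt g) = φ g :=
  (Finsupp.linearCombination_single k 1 g).trans (one_smul k _)

/-- The class of `g : [n] ⟶ c` in the cyclic coinvariants. -/
def cls (g : Lam.mk n ⟶ c) : ((cyclicResolution k).X n).obj c :=
  Submodule.Quotient.mk (p := chainRel ((linearYoneda k).obj c) n) (basisElt g)

theorem map_cls {c' : Lam} (u : c ⟶ c') (g : Lam.mk n ⟶ c) :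
    (((cyclicResolution k).X n).map u).hom (cls g) = cls (g ≫ u) :=
  congrArg (Submodule.Quotient.mk (p := chainRel ((linearYoneda k).obj c') n))
    Finsupp.mapDomain_single

theorem sub_chainCyc_basisElt (g : Lam.mk n ⟶ c) :
    (LinearMap.id - chainCyc ((linearYoneda k).obj c) n : _ →ₗ[k] _) (basisElt g) =
      basisElt g - (-1 : ℤ) ^ n • basisElt (tau _ ≫ g) := by
  rw [← map_basisElt]
  rfl

theorem tau_cls (g : Lam.mk n ⟶ c) :
    (-1 : ℤ) ^ n • (cls (tau _ ≫ g) : ((cyclicResolution k).X n).obj c) = cls g :=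
  ((Submodule.Quotient.eq (chainRel ((linearYoneda k).obj c) n)).2
    ⟨basisElt g, sub_chainCyc_basisElt g⟩).symm

theorem hom_ext {M : Type*} [AddCommGroup M] [Module k M]
    {f f' : ((cyclicResolution k).X n).obj c →ₗ[k] M}
    (h : ∀ g : Lam.mk n ⟶ c, f (cls g) = f' (cls g)) : f = f' :=
  Submodule.linearMap_qext (p := chainRel ((linearYoneda k).obj c) n) (f := f) (g := f')
    (basisElt_ext h)

/-- The map out of the cyclic coinvariants given by a cyclically invariant family. -/
def lift {M : Type*} [AddCommGroup M] [Module k M] (φ : (Lam.mk n ⟶ c) → M)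
    (hφ : ∀ g, (-1 : ℤ) ^ n • φ (tau _ ≫ g) = φ g) :
    ((cyclicResolution k).X n).obj c →ₗ[k] M :=
  (chainRel ((linearYoneda k).obj c) n).liftQ (linearExtension φ) (by
    rintro _ ⟨x, rfl⟩
    refine LinearMap.congr_fun (f := linearExtension φ ∘ₗ
      (LinearMap.id - chainCyc ((linearYoneda k).obj c) n)) (g := 0)
      (basisElt_ext fun g => ?_) x
    rw [LinearMap.comp_apply, sub_chainCyc_basisElt, map_sub, map_zsmul,
      linearExtension_basisElt, linearExtension_basisElt, hφ, sub_self]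
    rfl)

theorem lift_cls {M : Type*} [AddCommGroup M] [Module k M] (φ : (Lam.mk n ⟶ c) → M)
    (hφ : ∀ g, (-1 : ℤ) ^ n • φ (tau _ ≫ g) = φ g) (g : Lam.mk n ⟶ c) :
    lift (k := k) φ hφ (cls g) = φ g :=
  linearExtension_basisElt φ g

theorem d_cls (g : Lam.mk (n + 1) ⟶ c) :
    (((cyclicResolution k).d (n + 1) n).app c).hom (cls g) =
      ∑ j : Fin (n + 2), (-1 : ℤ) ^ (j : ℕ) • cls (coface j ≫ g) := by
  have e := cyclicChain_d ((linearYoneda k).obj c) n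
  refine (congrArg (fun f => f.hom (cls g)) e).trans ?_
  refine (congrArg (chainRel ((linearYoneda k).obj c) n).mkQ
    (chainD_apply ((linearYoneda k).obj c) n (basisElt g))).trans ?_
  rw [map_sum]
  refine Finset.sum_congr rfl fun j _ => ?_
  rw [map_zsmul]
  congr 1
  exact congrArg (chainRel ((linearYoneda k).obj c) n).mkQ (map_basisElt _ g)

end cyclicResolution

end ConnesCyclic

namespace ConnesCyclic

open RelativeHomology

variable {k : Type u} [Field k]

namespace cyclicResolution

/-! #### Maps out of the terms of the resolution -/

theorem mem_cochainInv {Y : CocyclicModule k} {n : ℕ} {y : Y.obj ⟨n⟩} :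
    y ∈ cochainInv Y n ↔ (-1 : ℤ) ^ n • (Y.map (tau ⟨n⟩)).hom y = y :=
  LinearMap.mem_ker.trans (sub_eq_zero.trans eq_comm)

theorem tau_map_inv {Y : CocyclicModule k} {n : ℕ} (y : cochainInv Y n) {c : Lam}
    (g : Lam.mk n ⟶ c) :
    (-1 : ℤ) ^ n • (Y.map (tau _ ≫ g)).hom y = (Y.map g).hom (y : Y.obj ⟨n⟩) := by
  rw [Y.map_comp, ModuleCat.hom_comp, LinearMap.comp_apply, ← map_zsmul, mem_cochainInv.1 y.2]

/-- The map `P_n(c) → Y_c` classified by a cyclic invariant of `Y_n`. -/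
def liftInv {Y : CocyclicModule k} {n : ℕ} (y : cochainInv Y n) (c : Lam) :
    ((cyclicResolution k).X n).obj c →ₗ[k] Y.obj c :=
  lift (fun g => (Y.map g).hom y) (tau_map_inv y)

theorem liftInv_cls {Y : CocyclicModule k} {n : ℕ} (y : cochainInv Y n) {c : Lam}
    (g : Lam.mk n ⟶ c) : liftInv y c (cls g) = (Y.map g).hom y :=
  lift_cls _ _ g

/-- The map `P_n ⟶ Y` classified by a cyclic invariant of `Y_n`. -/
def homOfInv {Y : CocyclicModule k} {n : ℕ} (y : cochainInv Y n) :
    (cyclicResolution k).X n ⟶ Y where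
  app c := ModuleCat.ofHom (X := ((cyclicResolution k).X n).obj c) (liftInv y c)
  naturality c c' u := by
    refine ModuleCat.hom_ext (hom_ext fun g => ?_)
    refine (congrArg (liftInv y c') (map_cls u g)).trans ((liftInv_cls _ _).trans ?_)
    refine Eq.trans ?_ (congrArg (Y.map u).hom (liftInv_cls y g).symm)
    rw [Y.map_comp]
    rfl

theorem homOfInv_app_cls {Y : CocyclicModule k} {n : ℕ} (y : cochainInv Y n) {c : Lam}
    (g : Lam.mk n ⟶ c) : ((homOfInv y).app c).hom (cls g) = (Y.map g).hom y :=
  liftInv_cls y g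

/-- The Yoneda argument: `[g]` is the image of the class of the identity under `g`, so naturality
determines `f` from one value. -/
theorem app_cls {Y : CocyclicModule k} {n : ℕ} (f : (cyclicResolution k).X n ⟶ Y) {c : Lam}
    (g : Lam.mk n ⟶ c) :
    (f.app c).hom (cls g) = (Y.map g).hom ((f.app ⟨n⟩).hom (cls (𝟙 _))) := by
  have h := congrArg (fun φ => φ.hom (cls (𝟙 _))) (f.naturality g)
  simp only [ModuleCat.hom_comp, LinearMap.comp_apply] at h
  rw [← h, map_cls, Category.id_comp]

/-- The universal element is itself invariant: `(-1)^n [τ_n] = [id]` by `tau_cls`, and `f` carries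
this relation to `Y_n`. -/
theorem app_cls_id_mem {Y : CocyclicModule k} {n : ℕ} (f : (cyclicResolution k).X n ⟶ Y) :
    (f.app ⟨n⟩).hom (cls (𝟙 _)) ∈ cochainInv Y n := by
  rw [mem_cochainInv, ← app_cls, ← map_zsmul, ← Category.comp_id (tau ⟨n⟩), tau_cls]

theorem nat_ext {Y : CocyclicModule k} {n : ℕ} {f f' : (cyclicResolution k).X n ⟶ Y}
    (h : (f.app ⟨n⟩).hom (cls (𝟙 _)) = (f'.app ⟨n⟩).hom (cls (𝟙 _))) : f = f' := by
  ext c : 2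
  refine ModuleCat.hom_ext (hom_ext fun g => ?_)
  rw [app_cls f, app_cls f', h]

/-- Maps out of `P_n` are cyclic invariants. -/
def homEquiv (Y : CocyclicModule k) (n : ℕ) :
    ((cyclicResolution k).X n ⟶ Y) ≃ₗ[k] cochainInv Y n where
  toFun f := ⟨(f.app ⟨n⟩).hom (cls (𝟙 _)), app_cls_id_mem f⟩
  map_add' _ _ := rfl
  map_smul' _ _ := rfl
  invFun := homOfInv
  left_inv f := nat_ext ((homOfInv_app_cls _ _).trans (by rw [Y.map_id]; rfl))
  right_inv y := Subtype.ext ((homOfInv_app_cls _ _).trans (by rw [Y.map_id]; rfl))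

/-- A section equivariant for the signed operators maps invariants to invariants. Through `homEquiv`
this is exactly the lifting property of `P_n`. -/
theorem exists_invariant_lift [CharZero k] {X Y : CocyclicModule k} (f : X ⟶ Y) [Epi f] {n : ℕ}
    {y : Y.obj ⟨n⟩} (hy : y ∈ cochainInv Y n) :
    ∃ x ∈ cochainInv X n, (f.app ⟨n⟩).hom x = y := by
  have hs : Function.Surjective (f.app ⟨n⟩).hom :=
    (ModuleCat.epi_iff_surjective _).1 ((NatTrans.epi_iff_epi_app f).1 inferInstance ⟨n⟩)
  have hc : (f.app ⟨n⟩).hom ∘ₗ cochainCyc X n = cochainCyc Y n ∘ₗ (f.app ⟨n⟩).hom := by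
    ext x
    refine (map_zsmul (f.app ⟨n⟩).hom _ _).trans (congrArg (((-1 : ℤ) ^ n) • ·) ?_)
    exact congrArg (fun φ => φ.hom x) (f.naturality (tau ⟨n⟩))
  obtain ⟨s, hs, hs'⟩ := exists_equivariant_section (cochainCyc_pow X n) (cochainCyc_pow Y n) hs hc
  refine ⟨s y, mem_cochainInv.2 ?_, LinearMap.congr_fun hs y⟩
  exact (LinearMap.congr_fun hs' y).trans (congrArg s (mem_cochainInv.1 hy))

theorem projective [CharZero k] (n : ℕ) : Projective ((cyclicResolution k).X n) where
  factors p f _ := by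
    obtain ⟨x, hx, h⟩ := exists_invariant_lift f (app_cls_id_mem p)
    refine ⟨homOfInv ⟨x, hx⟩, nat_ext ?_⟩
    rw [← h]
    refine congrArg (f.app ⟨n⟩).hom ((homOfInv_app_cls _ _).trans ?_)
    rw [CategoryTheory.Functor.map_id]
    rfl

theorem d_app_cls_id (n : ℕ) :
    (((cyclicResolution k).d (n + 1) n).app ⟨n + 1⟩).hom (cls (𝟙 _)) =
      ∑ j : Fin (n + 2), (-1 : ℤ) ^ (j : ℕ) • cls (coface j) :=
  (d_cls _).trans (by simp only [Category.comp_id])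

/-- `Hom_Λ(P_*, Y)` is the complex of cyclic invariants of `Y`. -/
def homComplexIso (Y : CocyclicModule k) :
    (homComplex (cyclicResolution k)).obj Y ≅ cyclicCochain.obj Y :=
  HomologicalComplex.Hom.isoOfComponents (fun n => (homEquiv Y n).toModuleIso) (by
    rintro n _ rfl
    refine ModuleCat.hom_ext (LinearMap.ext fun f => Subtype.ext ?_)
    refine (congrArg (fun φ => (φ.hom (homEquiv Y n f)).1) (cyclicCochain_d Y n)).trans ?_
    refine (cochainD_apply Y n _).trans ?_
    -- Both sides are the value of `f` on the boundary of the universal element of `P_{n+1}`.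
    have h : ∀ f : (cyclicResolution k).X n ⟶ Y,
        ∑ j : Fin (n + 2), (-1 : ℤ) ^ (j : ℕ) •
          (Y.map (coface j)).hom ((f.app ⟨n⟩).hom (cls (𝟙 _))) =
        (f.app ⟨n + 1⟩).hom ((((cyclicResolution k).d (n + 1) n).app ⟨n + 1⟩).hom (cls (𝟙 _))) := by
      intro f
      rw [d_app_cls_id, map_sum]
      refine Finset.sum_congr rfl fun j _ => ?_
      rw [map_zsmul, app_cls f (coface j)]
    exact h f)

/-- `Hom_Λ(P_*, -)` is the functor of cyclic invariants. -/
def homComplexNatIso : homComplex (cyclicResolution k) ≅ cyclicCochain :=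
  NatIso.ofComponents homComplexIso fun _ => rfl

/-! #### Tensor products with the terms of the resolution -/

/-- The map `X_n / (1 - (-1)^n τ_n) → X ⊗_Λ P_n`. -/
def toTensor (X : CyclicModule k) (n : ℕ) :
    (X.obj (op ⟨n⟩) ⧸ chainRel X n) →ₗ[k] Tensor X ((cyclicResolution k).X n) :=
  (chainRel X n).liftQ ((pureTensor X ((cyclicResolution k).X n) ⟨n⟩).flip (cls (𝟙 _))) (by
    rintro _ ⟨x, rfl⟩
    -- Balancing moves `τ_n` across the tensor sign, where the relation in `P_n` absorbs it together
    -- with its sign.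
    refine LinearMap.mem_ker.2 ((map_sub _ x _).trans (sub_eq_zero.2 ?_))
    refine Eq.trans ?_ (map_zsmul ((pureTensor X ((cyclicResolution k).X n) ⟨n⟩).flip
      (cls (𝟙 _))) ((-1 : ℤ) ^ n) ((X.map (tau ⟨n⟩).op).hom x)).symm
    rw [LinearMap.flip_apply, LinearMap.flip_apply, pureTensor_balanced, map_cls, ← map_zsmul,
      Category.id_comp, ← Category.comp_id (tau ⟨n⟩), tau_cls])

theorem toTensor_mk (X : CyclicModule k) (n : ℕ) (x : X.obj (op ⟨n⟩)) :
    toTensor X n (Submodule.Quotient.mk x) =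
      pureTensor X ((cyclicResolution k).X n) ⟨n⟩ x (cls (𝟙 _)) := rfl

/-- The bilinear map `X_c × P_n(c) → X_n / (1 - (-1)^n τ_n)`, `(x, [g]) ↦ [g^* x]`. -/
def coinvPairing (X : CyclicModule k) (n : ℕ) (c : Lam) :
    X.obj (op c) →ₗ[k] ((cyclicResolution k).X n).obj c →ₗ[k]
      (X.obj (op ⟨n⟩) ⧸ chainRel X n) :=
  LinearMap.flip (lift (fun g => (chainRel X n).mkQ ∘ₗ (X.map g.op).hom) fun g => by
    ext x
    refine ((Submodule.Quotient.eq (chainRel X n)).2 ⟨(X.map g.op).hom x, ?_⟩).symm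
    rw [op_comp, X.map_comp]
    rfl)

theorem coinvPairing_cls (X : CyclicModule k) (n : ℕ) (c : Lam) (x : X.obj (op c))
    (g : Lam.mk n ⟶ c) :
    coinvPairing X n c x (cls g) = Submodule.Quotient.mk ((X.map g.op).hom x) :=
  LinearMap.congr_fun (lift_cls (k := k)
    (fun g : Lam.mk n ⟶ c => (chainRel X n).mkQ ∘ₗ (X.map g.op).hom) _ g) x

theorem coinvPairing_balanced (X : CyclicModule k) (n : ℕ) {a b : Lam} (f : a ⟶ b)
    (x : X.obj (op b)) (p : ((cyclicResolution k).X n).obj a) :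
    coinvPairing X n a ((X.map f.op).hom x) p =
      coinvPairing X n b x ((((cyclicResolution k).X n).map f).hom p) := by
  refine LinearMap.congr_fun (f := coinvPairing X n a ((X.map f.op).hom x))
    (g := coinvPairing X n b x ∘ₗ (((cyclicResolution k).X n).map f).hom) (hom_ext fun g => ?_) p
  rw [LinearMap.comp_apply, map_cls, coinvPairing_cls, coinvPairing_cls, op_comp, X.map_comp]
  rfl

/-- The map `X ⊗_Λ P_n → X_n / (1 - (-1)^n τ_n)`. -/
def ofTensor (X : CyclicModule k) (n : ℕ) :
    Tensor X ((cyclicResolution k).X n) →ₗ[k] (X.obj (op ⟨n⟩) ⧸ chainRel X n) :=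
  tensorLift (coinvPairing X n) (coinvPairing_balanced X n)

theorem ofTensor_pureTensor_cls (X : CyclicModule k) (n : ℕ) {c : Lam} (x : X.obj (op c))
    (g : Lam.mk n ⟶ c) : ofTensor X n (pureTensor X _ c x (cls g)) =
      Submodule.Quotient.mk ((X.map g.op).hom x) :=
  (tensorLift_pureTensor _ (coinvPairing_balanced X n) c x _).trans (coinvPairing_cls X n c x g)

/-- `X ⊗_Λ P_n` is the module of cyclic coinvariants of `X_n`. -/
def tensorEquiv (X : CyclicModule k) (n : ℕ) :
    (X.obj (op ⟨n⟩) ⧸ chainRel X n) ≃ₗ[k] Tensor X ((cyclicResolution k).X n) :=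
  LinearEquiv.ofLinearMap (toTensor X n) (ofTensor X n)
    (tensor_ext fun c x p => by
      -- On generators this is the balancing identity `x ⊗ [g] = g^* x ⊗ [id]`.
      refine LinearMap.congr_fun (f := (toTensor X n ∘ₗ ofTensor X n) ∘ₗ pureTensor X _ c x)
        (g := pureTensor X _ c x) (hom_ext fun g => ?_) p
      rw [LinearMap.comp_apply, LinearMap.comp_apply, ofTensor_pureTensor_cls, toTensor_mk,
        pureTensor_balanced, map_cls, Category.id_comp])
    (Submodule.linearMap_qext _ (LinearMap.ext fun x => by
      refine (ofTensor_pureTensor_cls X n x (𝟙 _)).trans ?_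
      rw [op_id, X.map_id]
      rfl))

/-- `X ⊗_Λ P_*` is the complex of cyclic coinvariants of `X`. -/
def tensorComplexIso (X : CyclicModule k) :
    cyclicChain.obj X ≅ (tensorComplex (cyclicResolution k)).obj X :=
  HomologicalComplex.Hom.isoOfComponents (fun n => (tensorEquiv X n).toModuleIso) (by
    rintro _ n rfl
    refine ModuleCat.hom_ext (Submodule.linearMap_qext _ (LinearMap.ext fun x => ?_))
    have h : tensorMap (𝟙 X) ((cyclicResolution k).d (n + 1) n)
        (pureTensor X ((cyclicResolution k).X (n + 1)) ⟨n + 1⟩ x (cls (𝟙 _))) =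
        toTensor X n (Submodule.Quotient.mk ((chainD X n).hom x)) := by
      rw [tensorMap_pureTensor, d_app_cls_id, map_sum, chainD_apply, toTensor_mk, map_sum,
        LinearMap.sum_apply]
      refine Finset.sum_congr rfl fun j _ => ?_
      rw [map_zsmul, map_zsmul, LinearMap.smul_apply, pureTensor_balanced, map_cls,
        Category.id_comp]
      rfl
    refine h.trans ?_
    exact congrArg (fun φ => toTensor X n (φ.hom (Submodule.Quotient.mk x)))
      (cyclicChain_d X n).symm)

/-- `- ⊗_Λ P_*` is the functor of cyclic coinvariants. -/
def tensorComplexNatIso : cyclicChain ≅ tensorComplex (cyclicResolution k) :=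
  NatIso.ofComponents tensorComplexIso fun {X X'} φ => by
    ext n : 1
    refine ModuleCat.hom_ext (Submodule.linearMap_qext _ (LinearMap.ext fun x => ?_))
    refine Eq.trans ?_ (tensorMap_pureTensor φ (𝟙 _) _ x (cls (𝟙 _))).symm
    rfl

end cyclicResolution

end ConnesCyclic

namespace ConnesCyclic

/-! ### Acyclicity of `CH^λ_*(k[Λ(-, [m])])` -/

namespace PeriodicMap

variable {n m : ℕ}

/-- Periodicity makes `g` unbounded in both directions, so a least integer with nonnegative value
exists. The explicit bounds evaluate `g` at `q (n + 1)` with `q = -(|g 0| + 1)`, where it is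
negative, and `q = |g 0|`, where it is not. -/
theorem exists_start (g : PeriodicMap n m) : ∃ i, g.toFun (i - 1) < 0 ∧ 0 ≤ g.toFun i := by
  have hg (q : ℤ) : g.toFun (q * (n + 1)) = g.toFun 0 + q * (m + 1) := by
    rw [← g.map_add_mul_period, zero_add]
  obtain ⟨i, hi, hmin⟩ := Int.exists_least_of_bdd (P := fun x => 0 ≤ g.toFun x)
    ⟨-(|g.toFun 0| + 1) * (n + 1), fun z hz => by
      by_contra! h
      have h1 := g.monotone h.le
      rw [hg] at h1
      have h2 := le_abs_self (g.toFun 0)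
      nlinarith [abs_nonneg (g.toFun 0)]⟩
    ⟨|g.toFun 0| * (n + 1), by
      rw [hg]
      have h2 := neg_abs_le (g.toFun 0)
      nlinarith [abs_nonneg (g.toFun 0)]⟩
  exact ⟨i, by by_contra! h; linarith [hmin _ h], hi⟩

/-- The first integer at which `g` is nonnegative. -/
def start (g : PeriodicMap n m) : ℤ := g.exists_start.choose

theorem start_spec (g : PeriodicMap n m) : g.toFun (g.start - 1) < 0 ∧ 0 ≤ g.toFun g.start :=
  g.exists_start.choose_spec

theorem start_eq {g : PeriodicMap n m} {i : ℤ} (h : g.toFun (i - 1) < 0) (h' : 0 ≤ g.toFun i) :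
    g.start = i := by
  obtain ⟨h1, h1'⟩ := g.start_spec
  apply le_antisymm
  · by_contra! hlt
    exact absurd (g.monotone (show i ≤ g.start - 1 by omega)) (by omega)
  · by_contra! hlt
    exact absurd (g.monotone (show g.start ≤ i - 1 by omega)) (by omega)

theorem start_of_shift {g g' : PeriodicMap n m} {s : ℤ} (h : ∀ x, g'.toFun x = g.toFun (x + s)) :
    g'.start = g.start - s := by
  apply start_eq
  · rw [h, show g.start - s - 1 + s = g.start - 1 by ring]
    exact g.start_spec.1
  · rw [h, show g.start - s + s = g.start by ring]
    exact g.start_spec.2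

/-- The window of `n + 1` integers from `g.start` ends one period after `g.start - 1`, where `g` is
negative; so its values there stay below `m + 1`. -/
theorem normal_bound (g : PeriodicMap n m) (x : Fin (n + 1)) :
    0 ≤ g.toFun ((x : ℕ) + g.start) ∧ g.toFun ((x : ℕ) + g.start) < m + 1 := by
  obtain ⟨h1, h2⟩ := g.start_spec
  have hx := x.isLt
  constructor
  · exact h2.trans (g.monotone (by omega))
  · have := g.monotone (show ((x : ℕ) : ℤ) + g.start ≤ g.start - 1 + (n + 1) by omega)
    rw [g.map_add_period] at this
    linarith

/-- The order-preserving map obtained from `g` by a rotation of the source. -/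
def normal (g : PeriodicMap n m) : SimplexCategory.mk n ⟶ SimplexCategory.mk m :=
  SimplexCategory.Hom.mk
    { toFun := fun x => ⟨(g.toFun ((x : ℕ) + g.start)).toNat, by
        have := g.normal_bound x
        change _ < m + 1
        omega⟩
      monotone' := fun x y hxy => by
        rw [Fin.le_def]
        exact Int.toNat_le_toNat (g.monotone (by
          have : (x : ℕ) ≤ y := hxy
          omega)) }

theorem normal_apply (g : PeriodicMap n m) (x : Fin (n + 1)) :
    (((normal g).toOrderHom x : Fin (m + 1)) : ℕ) = (g.toFun ((x : ℕ) + g.start)).toNat := rfl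

/-- Makes the normal form invariant under rotations of the source, and also a function of the class
in `Λ`: adding `i (m + 1)` to the values amounts to shifting the source by `i (n + 1)`. -/
theorem normal_of_shift {g g' : PeriodicMap n m} {s : ℤ} (h : ∀ x, g'.toFun x = g.toFun (x + s)) :
    g'.normal = g.normal := by
  refine SimplexCategory.Hom.ext _ _ (OrderHom.ext _ _ (funext fun x => Fin.ext ?_))
  refine (normal_apply g' x).trans (Eq.trans ?_ (normal_apply g x).symm)
  rw [h, start_of_shift h]
  congr 2
  ring

/-- The factorisation of morphisms of `Λ` into a rotation and an order-preserving map, with the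
rotation moved to the other side. -/
theorem ofSimplex_normal (g : PeriodicMap n m) :
    ofSimplex.map g.normal = rot ⟨n⟩ g.start ≫ Lam.mkHom (a := ⟨n⟩) (b := ⟨m⟩) g := by
  refine Lam.mkHom_eq (a := ⟨n⟩) (b := ⟨m⟩) fun x => ?_
  obtain ⟨i, q, rfl⟩ := exists_fin_add n x
  change g.toFun ((i : ℕ) + q * (n + 1) + g.start) = (extend g.normal.toOrderHom).toFun _
  refine Eq.trans ?_ (extend_apply _ i q).symm
  have := (g.normal_bound i).1
  rw [show ((i : ℕ) : ℤ) + q * (n + 1) + g.start = (i : ℕ) + g.start + q * (n + 1) by ring,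
    map_add_mul_period]
  congr 1
  exact (Int.toNat_of_nonneg this).symm

theorem start_extend (f : Fin (n + 1) →o Fin (m + 1)) : (extend f).start = 0 := by
  apply start_eq
  -- Since `-1 = n - (n + 1)`, the value at `-1` is `f n - (m + 1)`, which is negative.
  · have := extend_apply f (Fin.last n) (-1)
    rw [Fin.val_last, show ((n : ℕ) : ℤ) + -1 * (n + 1) = 0 - 1 by ring] at this
    rw [this]
    have := (f (Fin.last n)).isLt
    omega
  · have := extend_apply f 0 0
    simp only [Fin.val_zero, zero_mul, add_zero, Nat.cast_zero] at this
    rw [this]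
    omega

theorem normal_extend (f : SimplexCategory.mk n ⟶ SimplexCategory.mk m) :
    (extend f.toOrderHom).normal = f := by
  refine SimplexCategory.Hom.ext _ _ (OrderHom.ext _ _ (funext fun x => Fin.ext ?_))
  refine (normal_apply _ x).trans ?_
  have h := extend_apply f.toOrderHom x 0
  rw [zero_mul, add_zero, zero_mul, add_zero] at h
  have h0 : (extend f.toOrderHom).start = 0 := start_extend f.toOrderHom
  rw [h0, add_zero]
  exact (congrArg Int.toNat h).trans (Int.toNat_natCast _)

end PeriodicMap

/-- The extension of `f : [n] ⟶ [m]` to `[n+1]` which sends the new first vertex to `0`. -/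
def simplexCone {n m : ℕ} (f : SimplexCategory.mk n ⟶ SimplexCategory.mk m) :
    SimplexCategory.mk (n + 1) ⟶ SimplexCategory.mk m :=
  SimplexCategory.Hom.mk
    { toFun := Fin.cases (motive := fun _ => Fin (m + 1)) 0 fun x => f.toOrderHom x
      monotone' := fun x y hxy => by
        induction x using Fin.cases with
        | zero => exact Fin.zero_le _
        | succ x =>
          induction y using Fin.cases with
          | zero => exact absurd hxy (by simp)
          | succ y => exact f.toOrderHom.monotone (Fin.succ_le_succ_iff.1 hxy) }

theorem delta_zero_simplexCone {n m : ℕ} (f : SimplexCategory.mk n ⟶ SimplexCategory.mk m) :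
    SimplexCategory.δ 0 ≫ simplexCone f = f :=
  SimplexCategory.Hom.ext _ _ (OrderHom.ext _ _ (funext fun _ => rfl))

/-- Faces that keep the apex commute with coning. Together with `delta_zero_simplexCone` this is the
whole combinatorial content of the contraction. -/
theorem delta_succ_simplexCone {n m : ℕ} (f : SimplexCategory.mk (n + 1) ⟶ SimplexCategory.mk m)
    (j : Fin (n + 2)) :
    SimplexCategory.δ j.succ ≫ simplexCone f = simplexCone (SimplexCategory.δ j ≫ f) := by
  refine SimplexCategory.Hom.ext _ _ (OrderHom.ext _ _ (funext fun x => ?_))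
  change (simplexCone f).toOrderHom (j.succ.succAbove x) = _
  induction x using Fin.cases with
  | zero => rw [Fin.succ_succAbove_zero]; rfl
  | succ x => rw [Fin.succ_succAbove_succ]; rfl

/-! ### The cone homotopy and exactness -/

namespace cyclicResolution

open RelativeHomology

variable {k : Type u} [Field k] {n m : ℕ}

theorem tau_cls' {c : Lam} (g : Lam.mk n ⟶ c) :
    (cls (tau _ ≫ g) : ((cyclicResolution k).X n).obj c) = (-1 : ℤ) ^ n • cls g := by
  rw [← tau_cls g, smul_smul, ← mul_pow, neg_one_mul, neg_neg, one_pow, one_smul]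

/-- Each unit of rotation contributes a factor `(-1)^n`; the induction runs in both directions
because `i` may be negative. -/
theorem rot_cls {c : Lam} (i : ℤ) (g : Lam.mk n ⟶ c) :
    (cls (rot _ i ≫ g) : ((cyclicResolution k).X n).obj c) =
      ((n * i).negOnePow : ℤ) • cls g := by
  have hn : ((n : ℤ).negOnePow : ℤ) = (-1) ^ n := by
    rw [Int.negOnePow_def, zpow_natCast]
    push_cast
    rfl
  have hτ (j : ℤ) : tau ⟨n⟩ ≫ rot ⟨n⟩ j ≫ g = rot ⟨n⟩ (j - 1) ≫ g := by
    rw [← Category.assoc]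
    congr 1
    refine Lam.mkHom_eq fun x => ?_
    change x + (j - 1) = x - 1 + j
    ring
  induction i with
  | zero =>
    rw [mul_zero, Int.negOnePow_zero, Units.val_one, one_smul]
    congr 1
    exact (congrArg (· ≫ g) (Lam.mkHom_eq fun x => (add_zero x).symm)).trans (Category.id_comp g)
  | succ i ih =>
    rw [← tau_cls, hτ, add_sub_cancel_right, ih, smul_smul, mul_add, mul_one, Int.negOnePow_add,
      Units.val_mul, hn, mul_comm]
  | pred i ih =>
    rw [← hτ, tau_cls', ih, smul_smul, mul_sub, mul_one, Int.negOnePow_sub,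
      Units.val_mul, hn, mul_comm]

/-- The class of an order-preserving map in the cyclic coinvariants. -/
def simplexCls (f : SimplexCategory.mk n ⟶ SimplexCategory.mk m) :
    ((cyclicResolution k).X n).obj ⟨m⟩ :=
  cls (ofSimplex.map f)

theorem cls_eq_normal (g : PeriodicMap n m) :
    (cls (Lam.mkHom (a := ⟨n⟩) (b := ⟨m⟩) g) : ((cyclicResolution k).X n).obj ⟨m⟩) =
      ((n * g.start).negOnePow : ℤ) • simplexCls g.normal := by
  rw [simplexCls, g.ofSimplex_normal]
  refine Eq.trans ?_ (congrArg _ (rot_cls _ _).symm)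
  rw [smul_smul, ← Units.val_mul, Int.units_mul_self, Units.val_one, one_smul]

/-- By `cls_eq_normal` every generator is a simplicial class up to sign, so simplicial classes span.
Identities for the homotopy then need checking only where no signs intervene. -/
theorem simplex_hom_ext {M : Type*} [AddCommGroup M] [Module k M]
    {f f' : ((cyclicResolution k).X n).obj ⟨m⟩ →ₗ[k] M}
    (h : ∀ θ : SimplexCategory.mk n ⟶ SimplexCategory.mk m,
      f (simplexCls θ) = f' (simplexCls θ)) : f = f' :=
  hom_ext fun g => by
    obtain ⟨g, rfl⟩ := Quotient.exists_rep g
    have e := cls_eq_normal (k := k) g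
    exact (congrArg f e).trans (((map_zsmul f _ _).trans
      ((congrArg _ (h _)).trans (map_zsmul f' _ _).symm)).trans (congrArg f' e.symm))

/-- The cone on the normal form of a morphism, with its sign. -/
def coneOfHom (g : Lam.mk n ⟶ Lam.mk m) : ((cyclicResolution k).X (n + 1)).obj ⟨m⟩ :=
  Quotient.lift (fun g : PeriodicMap n m =>
    ((n * g.start).negOnePow : ℤ) • (simplexCls (simplexCone g.normal) :
      ((cyclicResolution k).X (n + 1)).obj ⟨m⟩)) (by
    -- Another representative has its start moved by `i (n + 1)`, which alters the sign by `(-1)^(n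
    -- i (n + 1)) = 1`.
    rintro g g' ⟨i, h⟩
    have h' (x : ℤ) : g'.toFun x = g.toFun (x + i * (n + 1)) := by
      rw [h, g.map_add_mul_period]
    rw [PeriodicMap.start_of_shift h', PeriodicMap.normal_of_shift h', mul_sub, Int.negOnePow_sub,
      Int.negOnePow_even (n * (i * (n + 1))), mul_one]
    rw [mul_left_comm]
    exact (Int.even_mul_succ_self n).mul_left i) g

theorem coneOfHom_mkHom (g : PeriodicMap n m) :
    coneOfHom (k := k) (Lam.mkHom (a := ⟨n⟩) (b := ⟨m⟩) g) =
      ((n * g.start).negOnePow : ℤ) • simplexCls (simplexCone g.normal) := rfl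

/-- Precomposing with `τ_n` raises the start by one and keeps the normal form, so the sign changes
by exactly `(-1)^n`. This lets the cone descend to coinvariants. -/
theorem coneOfHom_tau (g : Lam.mk n ⟶ Lam.mk m) :
    (-1 : ℤ) ^ n • coneOfHom (k := k) (tau _ ≫ g) = coneOfHom g := by
  obtain ⟨g, rfl⟩ := Quotient.exists_rep g
  let g' : PeriodicMap n m :=
    PeriodicMap.comp ⟨fun x => x - 1, fun _ _ h => by simpa using h, fun _ => by ring⟩ g
  have h' (x : ℤ) : g'.toFun x = g.toFun (x + -1) := rfl
  refine (congrArg _ (coneOfHom_mkHom g')).trans (Eq.trans ?_ (coneOfHom_mkHom g).symm)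
  have hn : ((n : ℤ).negOnePow : ℤ) = (-1) ^ n := by
    rw [Int.negOnePow_def, zpow_natCast]
    push_cast
    rfl
  rw [PeriodicMap.start_of_shift h', PeriodicMap.normal_of_shift h', smul_smul, ← hn,
    ← Units.val_mul, ← Int.negOnePow_add, sub_neg_eq_add, mul_add, mul_one, Int.negOnePow_add,
    Int.negOnePow_add, mul_left_comm, Int.units_mul_self, mul_one]

variable (k n m) in
/-- The contracting homotopy. -/
def coneMap : ((cyclicResolution k).X n).obj ⟨m⟩ →ₗ[k] ((cyclicResolution k).X (n + 1)).obj ⟨m⟩ :=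
  lift coneOfHom coneOfHom_tau

theorem coneMap_simplexCls (θ : SimplexCategory.mk n ⟶ SimplexCategory.mk m) :
    coneMap k n m (simplexCls θ) = simplexCls (simplexCone θ) := by
  refine (lift_cls _ coneOfHom_tau _).trans ((coneOfHom_mkHom _).trans ?_)
  have h0 : (extend θ.toOrderHom).start = 0 := PeriodicMap.start_extend θ.toOrderHom
  have h1 := PeriodicMap.normal_extend θ
  refine (congrArg₂ (fun (i : ℤ) ν => ((n * i).negOnePow : ℤ) •
    (simplexCls (simplexCone ν) : ((cyclicResolution k).X (n + 1)).obj ⟨m⟩)) h0 h1).trans ?_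
  rw [mul_zero, Int.negOnePow_zero, Units.val_one, one_smul]

theorem d_simplexCls (θ : SimplexCategory.mk (n + 1) ⟶ SimplexCategory.mk m) :
    (((cyclicResolution k).d (n + 1) n).app ⟨m⟩).hom (simplexCls θ) =
      ∑ j : Fin (n + 2), (-1 : ℤ) ^ (j : ℕ) • simplexCls (SimplexCategory.δ j ≫ θ) := by
  refine (d_cls _).trans (Finset.sum_congr rfl fun j _ => ?_)
  rw [simplexCls, ofSimplex.map_comp]
  rfl

/-- Face `0` of the cone returns the simplex; the other faces are cones on its faces, with index
raised by one and hence opposite sign, and cancel the second summand. -/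
theorem d_coneMap_add (z : ((cyclicResolution k).X (n + 1)).obj ⟨m⟩) :
    (((cyclicResolution k).d (n + 2) (n + 1)).app ⟨m⟩).hom (coneMap k (n + 1) m z) +
      coneMap k n m ((((cyclicResolution k).d (n + 1) n).app ⟨m⟩).hom z) = z := by
  refine LinearMap.congr_fun (f := (((cyclicResolution k).d (n + 2) (n + 1)).app ⟨m⟩).hom ∘ₗ
    coneMap k (n + 1) m + coneMap k n m ∘ₗ (((cyclicResolution k).d (n + 1) n).app ⟨m⟩).hom)
    (g := LinearMap.id) (simplex_hom_ext fun θ => ?_) z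
  rw [LinearMap.add_apply, LinearMap.comp_apply, LinearMap.comp_apply, coneMap_simplexCls,
    d_simplexCls, d_simplexCls, map_sum, Fin.sum_univ_succ, delta_zero_simplexCone, Fin.val_zero,
    pow_zero, one_smul, LinearMap.id_apply, add_assoc, ← Finset.sum_add_distrib,
    Finset.sum_eq_zero, add_zero]
  intro j _
  rw [map_zsmul, coneMap_simplexCls, delta_succ_simplexCone, ← add_smul, Fin.val_succ, pow_succ,
    mul_neg_one, neg_add_cancel, zero_smul]

variable (k) in
/-- The augmentation of the resolution. -/
def augmentation : (cyclicResolution k).X 0 ⟶ trivialModule k :=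
  homOfInv (Y := trivialModule k) (n := 0) ⟨(1 : k), mem_cochainInv.2 (one_smul ℤ (1 : k))⟩

theorem augmentation_cls {c : Lam} (g : Lam.mk 0 ⟶ c) :
    ((augmentation k).app c).hom (cls g) = (1 : k) :=
  homOfInv_app_cls _ g

/-- By Yoneda only the universal element of `P_1` matters; its two endpoints have augmentation `1`
and opposite signs. -/
theorem d_augmentation : (cyclicResolution k).d 1 0 ≫ augmentation k = 0 := by
  refine nat_ext ?_
  change ((augmentation k).app ⟨1⟩).hom
    ((((cyclicResolution k).d 1 0).app ⟨1⟩).hom (cls (𝟙 _))) = 0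
  rw [d_app_cls_id, Fin.sum_univ_two, map_add, map_zsmul, map_zsmul]
  refine (congrArg₂ (fun a b : k => (-1 : ℤ) ^ 0 • a + (-1 : ℤ) ^ 1 • b)
    (augmentation_cls _) (augmentation_cls _)).trans ?_
  simp

/-- The vertex `0` of `[m]`. -/
def vertex (m : ℕ) : SimplexCategory.mk 0 ⟶ SimplexCategory.mk m :=
  SimplexCategory.const _ _ 0

/-- The cone on a vertex `θ` is the edge from `0` to `θ`, whose boundary is `θ` minus the vertex
`0`; the augmentation restores the missing term. -/
theorem d_coneMap_zero (z : ((cyclicResolution k).X 0).obj ⟨m⟩) :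
    (((cyclicResolution k).d 1 0).app ⟨m⟩).hom (coneMap k 0 m z) +
      (((augmentation k).app ⟨m⟩).hom z : k) • simplexCls (vertex m) = z := by
  refine LinearMap.congr_fun (f := (((cyclicResolution k).d 1 0).app ⟨m⟩).hom ∘ₗ coneMap k 0 m +
    LinearMap.toSpanSingleton k _ (simplexCls (vertex m)) ∘ₗ ((augmentation k).app ⟨m⟩).hom)
    (g := LinearMap.id) (simplex_hom_ext fun θ => ?_) z
  have h1 : SimplexCategory.δ 1 ≫ simplexCone θ = vertex m := by
    refine SimplexCategory.Hom.ext _ _ (OrderHom.ext _ _ (funext fun x => ?_))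
    obtain rfl : x = 0 := Subsingleton.elim (α := Fin 1) x 0
    rfl
  have h2 : ((augmentation k).app ⟨m⟩).hom (simplexCls θ) = (1 : k) := augmentation_cls _
  rw [LinearMap.add_apply, LinearMap.comp_apply, LinearMap.comp_apply, coneMap_simplexCls,
    d_simplexCls, Fin.sum_univ_two, delta_zero_simplexCone, h1, h2]
  refine (congrArg (_ + ·) (LinearMap.toSpanSingleton_apply_one k _ _)).trans ?_
  simp

theorem exact_zero : (ShortComplex.mk _ _ (d_augmentation (k := k))).Exact :=
  exact_of_exact_app fun ⟨m⟩ => by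
    rw [ShortComplex.moduleCat_exact_iff]
    intro z hz
    refine ⟨coneMap k 0 m z, ?_⟩
    have h := d_coneMap_zero z
    have hz' : ((augmentation k).app ⟨m⟩).hom z = (0 : k) := hz
    rw [hz', zero_smul, add_zero] at h
    exact h

theorem exact_succ (n : ℕ) :
    (ShortComplex.mk _ _ ((cyclicResolution k).d_comp_d (n + 2) (n + 1) n)).Exact :=
  exact_of_exact_app fun ⟨m⟩ => by
    rw [ShortComplex.moduleCat_exact_iff]
    intro z hz
    refine ⟨coneMap k (n + 1) m z, ?_⟩
    have h := d_coneMap_add z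
    have hz' : (((cyclicResolution k).d (n + 1) n).app ⟨m⟩).hom z = 0 := hz
    rw [hz', map_zero, add_zero] at h
    exact h

theorem epi_augmentation : Epi (augmentation k) := by
  rw [NatTrans.epi_iff_epi_app]
  rintro ⟨m⟩
  rw [ModuleCat.epi_iff_surjective]
  have key (r : k) : ((augmentation k).app ⟨m⟩).hom (r • simplexCls (vertex m)) = r :=
    (map_smul ((augmentation k).app ⟨m⟩).hom _ _).trans
      ((congrArg (fun a : k => r • a) (augmentation_cls _)).trans (mul_one r))
  exact fun r => ⟨_, key r⟩

variable (k) in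
/-- `CH^λ_*(k[Λ(-, c)])` as a `(Λ, T)`-projective resolution of the trivial module. -/
def relResolution [CharZero k] : RelProjectiveResolution rotInclusion (trivialModule k) :=
  RelProjectiveResolution.ofExact isSplitEpi_of_epi_rot (cyclicResolution k) projective
    (augmentation k) epi_augmentation d_augmentation exact_zero exact_succ

end cyclicResolution

/-! ### Independence of the resolution and conclusion -/

open RelativeHomology in
/-- Any `(Λ, T)`-projective resolution of the trivial module is homotopy equivalent to the
canonical one. -/
def homotopyEquivCyclicResolution {k : Type u} [Field k] [CharZero k]
    (P : RelProjectiveResolution rotInclusion (trivialModule k)) :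
    HomotopyEquiv P.complex (cyclicResolution k) :=
  ProjectiveResolution.homotopyEquiv (P.toProjectiveResolution isSplitEpi_of_epi_rot)
    ((cyclicResolution.relResolution k).toProjectiveResolution isSplitEpi_of_epi_rot)

end ConnesCyclic

end

theorem mainTheorem2 (k : Type u) [Field k] [CharZero k] :
    Nonempty (RelativeHomology.RelProjectiveResolution ConnesCyclic.rotInclusion
      (ConnesCyclic.trivialModule k)) ∧
    ∀ P : RelativeHomology.RelProjectiveResolution ConnesCyclic.rotInclusion
        (ConnesCyclic.trivialModule k), ∀ n : ℕ,
      Nonempty (RelativeHomology.relTor P n ≅ ConnesCyclic.cyclicHomology k n) ∧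
      Nonempty (RelativeHomology.relExt P n ≅ ConnesCyclic.cyclicCohomology k n) :=
  ⟨⟨ConnesCyclic.cyclicResolution.relResolution k⟩, fun P n =>
    ⟨⟨RelativeHomology.tensorHomologyIso (ConnesCyclic.homotopyEquivCyclicResolution P) n ≪≫
      Functor.isoWhiskerRight ConnesCyclic.cyclicResolution.tensorComplexNatIso.symm _⟩,
    -- The Hom complex is contravariant in the resolution, hence the inverse here and not for Tor.
    ⟨(RelativeHomology.homCohomologyIso (ConnesCyclic.homotopyEquivCyclicResolution P) n).symm ≪≫
      Functor.isoWhiskerRight ConnesCyclic.cyclicResolution.homComplexNatIso _⟩⟩⟩
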